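/- Let $\overline{S_3}(n)$ denote the number of $3$-Schur overpartitions of $n$, defined by the identity of formal power series $$\sum_{n\ge 0}\overline{S_3}(n)q^n=\prod_{n\ge 1}\frac{(1+q^{2n-1})(1-q^{3(2n-1)})}{(1+q^{3(2n-1)})(1-q^{2n-1})}.$$ For all integers $n\ge 0$ and $\alpha\ge 0$: $$\overline{S_3}(2^\alpha\cdot 2n)\equiv\overline{S_3}(2n)\pmod 4,$$ $$\overline{S_3}(3^\alpha(2n+1))\equiv\overline{S_3}(2n+1)\pmod 4,$$ $$\overline{S_3}(32n+20)\equiv 0\pmod 4,$$ $$\overline{S_3}(96n+16j+12)\equiv 0\pmod 4\quad\text{for each } j\in\{1,2,3,4,5\},$$ $$\overline{S_3}(3^\alpha(12n+6))\equiv(-1)^\alpha\,\overline{S_3}(12n+6)\pmod 9,$$ $$\overline{S_3}(3^\alpha(12n+6))\equiv\overline{S_3}(12n+6)\pmod{12},$$ $$\overline{S_3}(144n+24i+18)\equiv 0\pmod{12}\quad\text{for each } i\in\{1,2,3,4,5\},$$ $$\overline{S_3}(48n+30)\equiv 0\pmod{12},$$ $$\overline{S_3}(48n+42)\equiv 0\pmod{12},$$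 $$\overline{S_3}(48n+46)\equiv 0\pmod{16},$$ $$\overline{S_3}(24n+22)\equiv 0\pmod{24}.$$ -/

import Mathlib

/-- The `k`-th factor (`k = 0, 1, 2, …`, with `m = 2k + 1` the `k`-th odd positive integer)
`((1 + q^m) (1 - q^(t m))) / ((1 + q^(t m)) (1 - q^m))`, as a formal power series in `q` over `ℤ`.
For `t ≥ 1` the denominator has constant coefficient `1`, so `PowerSeries.invOfUnit _ 1` is its
inverse; see `schurOverFactor_mul`. -/
noncomputable def schurOverFactor (t k : ℕ) : PowerSeries ℤ :=
  ((1 + PowerSeries.X ^ (2 * k + 1)) * (1 - PowerSeries.X ^ (t * (2 * k + 1)))) *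
    PowerSeries.invOfUnit
      ((1 + PowerSeries.X ^ (t * (2 * k + 1))) * (1 - PowerSeries.X ^ (2 * k + 1))) 1

open scoped PowerSeries.WithPiTopology in
/-- The infinite product of the factors `schurOverFactor t k`, `k ≥ 0`, in `ℤ⟦q⟧` with the topology
of coefficientwise convergence (`ℤ` discrete). It converges for `t ≥ 1`; see
`multipliable_schurOverFactor`. -/
noncomputable def schurOverGenFun (t : ℕ) : PowerSeries ℤ :=
  ∏' k : ℕ, schurOverFactor t k

/-- The number of `t`-Schur overpartitions of `n` (for odd `t ≥ 3`), defined by its generating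
function. -/
noncomputable def schurOver (t n : ℕ) : ℤ :=
  PowerSeries.coeff n (schurOverGenFun t)

/-- The factor is the quotient it is meant to be. -/
theorem schurOverFactor_mul {t : ℕ} (ht : 1 ≤ t) (k : ℕ) :
    schurOverFactor t k *
        ((1 + PowerSeries.X ^ (t * (2 * k + 1))) * (1 - PowerSeries.X ^ (2 * k + 1))) =
      (1 + PowerSeries.X ^ (2 * k + 1)) * (1 - PowerSeries.X ^ (t * (2 * k + 1))) := by
  have h0 : t * (2 * k + 1) ≠ 0 := by positivity
  unfold schurOverFactor
  rw [mul_assoc, PowerSeries.invOfUnit_mul _ _ (by simp [h0]), mul_one]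

open scoped PowerSeries.WithPiTopology in
/-- The infinite product converges. -/
theorem multipliable_schurOverFactor {t : ℕ} (ht : 1 ≤ t) :
    Multipliable (schurOverFactor t) := by
  have key : ∀ k : ℕ, ((2 * k + 1 : ℕ) : ℕ∞) ≤ (schurOverFactor t k - 1).order := by
    intro k
    have h0 : t * (2 * k + 1) ≠ 0 := by positivity
    have hu := PowerSeries.mul_invOfUnit
      ((1 + PowerSeries.X ^ (t * (2 * k + 1))) * (1 - PowerSeries.X ^ (2 * k + 1)) :
        PowerSeries ℤ) 1 (by simp [h0])
    refine PowerSeries.nat_le_order _ _ (PowerSeries.X_pow_dvd_iff.mp ?_)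
    obtain ⟨s, rfl⟩ : ∃ s, t = s + 1 := ⟨t - 1, by omega⟩
    refine ⟨(2 - 2 * PowerSeries.X ^ (s * (2 * k + 1))) * PowerSeries.invOfUnit
      ((1 + PowerSeries.X ^ ((s + 1) * (2 * k + 1))) * (1 - PowerSeries.X ^ (2 * k + 1))) 1, ?_⟩
    unfold schurOverFactor
    generalize PowerSeries.invOfUnit (_ : PowerSeries ℤ) 1 = I at hu ⊢
    have e : (PowerSeries.X : PowerSeries ℤ) ^ ((s + 1) * (2 * k + 1)) =
      PowerSeries.X ^ (s * (2 * k + 1)) * PowerSeries.X ^ (2 * k + 1) := by ring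
    linear_combination hu - 2 * I * e
  have h := PowerSeries.WithPiTopology.multipliable_one_add_of_tendsto_order_atTop_nhds_top
    (f := fun k => schurOverFactor t k - 1) (R := ℤ) (by
      rw [ENat.tendsto_nhds_top_iff_natCast_lt]
      intro n
      filter_upwards [Filter.eventually_ge_atTop n] with k hk
      refine lt_of_lt_of_le ?_ (key k)
      exact_mod_cast (by omega : n < 2 * k + 1))
  simpa using h

/-! Write S(n) for the coefficients and E_k for `euler k`. Jacobi's triple product turns the
infinite product into theta functions: φ(-q²)φ(-q⁶) ∑ S(n)qⁿ = φ(q)φ(-q³). Everything then rests on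
dissecting this quotient and reducing it modulo small primes.

Modulo 4: φ(±q^k) ≡ 1 + 2∑q^(km²), and such series are their own inverses, so for n > 0, S(n) ≡
2·#{k ∣ 6 : n is k times a positive square} (`schurOver_modEq_squareCount`). Multiplying n by 2 or 3
permutes the four forms k·□, which gives the invariance statements; the vanishing statements are
residue obstructions modulo 8 and 3.

Dissection: two 2-dissections give φ(-q)φ(-q³) ∑ S(4n+2)qⁿ = 2ψ(q)ψ(q³) (`schurFourTwo_mul`).
Clearing φ(-q) by its norm over cube roots of unity, a 3-dissection produces theta quotients with
prefactor 6 for S(12n+6) and 12 for S(12n+10) (`sect_three_schurFourTwo`).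

Modulo 9: S(12n+6)/3 is modulo 3 the coefficient of 2V with V = ψ(q)φ(-q)ψ(q³)φ(-q³), and extracting
the exponents 3n+1 sends V to -V. Each tripling of the argument therefore changes the sign modulo 9.
The modulus 12 results combine divisibility by 3 with the analysis modulo 4.

Moduli 24 and 16: S(12n+10)/12 has a generating function M whose numerator E₂E₆³ is a series in q².
Modulo 2 the denominator is 1, so the odd coefficients of M are even. Modulo 4 the odd part of M is
again a series in q² up to congruence, so the coefficients at 4n+3 vanish. -/

open Filter PowerSeries
open scoped Topology PowerSeries.WithPiTopology

/-! ### Theta series and q-products: convergence -/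

/-- The triangular number `k (k + 1) / 2` of an integer. -/
def triangular (k : ℤ) : ℕ := (k * (k + 1) / 2).toNat

theorem two_mul_triangular (k : ℤ) : 2 * (triangular k : ℤ) = k * (k + 1) := by
  have h : 0 ≤ k * (k + 1) := by
    rcases le_or_gt 0 k with h | h
    · positivity
    · nlinarith
  have h2 : 2 ∣ k * (k + 1) := (Int.even_mul_succ_self k).two_dvd
  unfold triangular
  omega

/-- `∑ₖ sᵏ q^(u k(k+1)/2 + v k(k-1)/2)`, Ramanujan's theta function `f(s q^u, s q^v)`. -/
noncomputable def theta (s : ℤˣ) (u v : ℕ) : PowerSeries ℤ :=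
  ∑' k : ℤ, (((s ^ k : ℤˣ) : ℤ) : PowerSeries ℤ) * X ^ (u * triangular k + v * triangular (-k))

/-- `∏ₙ (1 + s q^(m n + r))`. -/
noncomputable def pochProd (s : ℤˣ) (m r : ℕ) : PowerSeries ℤ :=
  ∏' n : ℕ, (1 + ((s : ℤ) : PowerSeries ℤ) * X ^ (m * n + r))

theorem coeff_intCast_mul_X_pow (c : ℤ) (n e : ℕ) :
    coeff n ((c : PowerSeries ℤ) * X ^ e) = if n = e then c else 0 := by
  rw [← map_intCast (C (R := ℤ)), coeff_C_mul, coeff_X_pow]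
  simp

theorem summable_intCast_mul_X_pow {ι : Type*} (w : ι → ℤ) (e : ι → ℕ)
    (h : ∀ n, {i | e i ≤ n}.Finite) :
    Summable fun i => (w i : PowerSeries ℤ) * X ^ e i := by
  rw [WithPiTopology.summable_iff_summable_coeff]
  intro n
  refine summable_of_hasFiniteSupport ((h n).subset fun i hi => ?_)
  simp only [Function.mem_support, coeff_intCast_mul_X_pow] at hi
  simp only [Set.mem_ofPred_eq]
  by_contra hc
  exact hi (if_neg (by omega))

/-- The two triangular numbers add up to k², so this growth bound makes theta series summable
coefficientwise. -/
theorem natAbs_le_triangular_add (k : ℤ) {u v : ℕ} (hu : 0 < u) (hv : 0 < v) :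
    k.natAbs ≤ u * triangular k + v * triangular (-k) := by
  have h1 := two_mul_triangular k
  have h2 := two_mul_triangular (-k)
  have h3 : (k.natAbs : ℤ) ≤ triangular k + triangular (-k) := by
    have : |k| ≤ k ^ 2 := by
      rw [← sq_abs]
      rcases (abs_nonneg k).eq_or_lt with h | h
      · rw [← h]; norm_num
      · nlinarith
    rw [Int.natCast_natAbs]
    nlinarith
  have h4 := Nat.le_mul_of_pos_left (triangular k) hu
  have h5 := Nat.le_mul_of_pos_left (triangular (-k)) hv
  omega

theorem finite_setOf_natAbs_le (n : ℕ) : {k : ℤ | k.natAbs ≤ n}.Finite :=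
  (Set.finite_Icc (-n : ℤ) n).subset fun k hk => by
    simp only [Set.mem_ofPred_eq] at hk
    constructor <;> omega

theorem hasSum_theta (s : ℤˣ) {u v : ℕ} (hu : 0 < u) (hv : 0 < v) :
    HasSum (fun k : ℤ => (((s ^ k : ℤˣ) : ℤ) : PowerSeries ℤ) *
      X ^ (u * triangular k + v * triangular (-k))) (theta s u v) :=
  (summable_intCast_mul_X_pow _ _ fun n => (finite_setOf_natAbs_le n).subset fun k hk =>
    (natAbs_le_triangular_add k hu hv).trans hk).hasSum

theorem multipliable_one_add_of_X_pow_dvd (f : ℕ → PowerSeries ℤ) (h : ∀ n, X ^ n ∣ f n) :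
    Multipliable fun n => 1 + f n := by
  refine WithPiTopology.multipliable_one_add_of_tendsto_order_atTop_nhds_top ℤ ?_
  rw [ENat.tendsto_nhds_top_iff_natCast_lt]
  intro n
  filter_upwards [eventually_ge_atTop (n + 1)] with k hk
  refine lt_of_lt_of_le ?_ (nat_le_order _ _ (X_pow_dvd_iff.mp (h k)))
  exact_mod_cast (by omega : n < k)

theorem multipliable_pochProd (s : ℤˣ) {m : ℕ} (hm : 0 < m) (r : ℕ) :
    Multipliable fun n : ℕ => 1 + ((s : ℤ) : PowerSeries ℤ) * X ^ (m * n + r) := by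
  refine multipliable_one_add_of_X_pow_dvd _ fun n => dvd_mul_of_dvd_right (pow_dvd_pow X ?_) _
  nlinarith [Nat.le_mul_of_pos_left n hm]

/-! ### A finite form of the triple product -/

section FiniteIdentity

variable {R : Type*} [CommRing R]

/-- `1 / ∏_{i < m} (1 - Q^(i+1))` in terms of given inverses `g i` of `1 - Q^(i+1)`; zero for
negative `m`. -/
def recipPoch (g : ℕ → R) (m : ℤ) : R := if m < 0 then 0 else ∏ i ∈ Finset.range m.toNat, g i

theorem recipPoch_sub_one {Q : R} {g : ℕ → R} (hg : ∀ i, g i * (1 - Q ^ (i + 1)) = 1) (m : ℤ) :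
    recipPoch g (m - 1) = recipPoch g m * (1 - Q ^ m.toNat) := by
  rcases lt_trichotomy m 0 with h | rfl | h
  · simp [recipPoch, h, show m - 1 < 0 by omega]
  · simp [recipPoch]
  · obtain ⟨n, rfl⟩ : ∃ n : ℕ, m = n + 1 := ⟨(m - 1).toNat, by omega⟩
    have h1 : ¬ ((n : ℤ) < 0) := by omega
    have h2 : ¬ ((n : ℤ) + 1 < 0) := by omega
    have h3 : ((n : ℤ) + 1).toNat = n + 1 := by omega
    simp only [recipPoch, add_sub_cancel_right, h1, h2, if_false, h3, Int.toNat_natCast,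
      Finset.prod_range_succ]
    rw [mul_assoc, hg, mul_one]

/-- The coefficients of the finite form of the triple product, Gaussian binomials. -/
def centralGauss (Q : R) (g : ℕ → R) (N : ℕ) (k : ℤ) : R :=
  (∏ i ∈ Finset.range (2 * N), (1 - Q ^ (i + 1))) * recipPoch g (N - k) * recipPoch g (N + k)

theorem centralGauss_of_lt (Q : R) (g : ℕ → R) {N : ℕ} {k : ℤ} (h : k < -N ∨ (N : ℤ) < k) :
    centralGauss Q g N k = 0 := by
  rcases h with h | h
  · simp [centralGauss, recipPoch, show (N : ℤ) + k < 0 by omega]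
  · simp [centralGauss, recipPoch, show (N : ℤ) - k < 0 by omega]

/-- The recurrence matching multiplication by (1 + aQ^N)(1 + bQ^N) = 1 + Q^(2N+1) + aQ^N + bQ^N when
ab = Q. -/
theorem centralGauss_succ {Q : R} {g : ℕ → R} (hg : ∀ i, g i * (1 - Q ^ (i + 1)) = 1) {N : ℕ}
    {k : ℤ} (hk : k ∈ Finset.Icc (-(N + 1) : ℤ) (N + 1)) :
    centralGauss Q g (N + 1) k = (1 + Q ^ (2 * N + 1)) * centralGauss Q g N k +
      Q ^ (N + 1 - k : ℤ).toNat * centralGauss Q g N (k - 1) +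
      Q ^ (N + 1 + k : ℤ).toNat * centralGauss Q g N (k + 1) := by
  rw [Finset.mem_Icc] at hk
  have a1 := recipPoch_sub_one hg ((N : ℤ) + 1 - k)
  have a2 := recipPoch_sub_one hg ((N : ℤ) - k)
  have b1 := recipPoch_sub_one hg ((N : ℤ) + 1 + k)
  have b2 := recipPoch_sub_one hg ((N : ℤ) + k)
  have hAB : Q ^ (N + 1 - k : ℤ).toNat * Q ^ (N + 1 + k : ℤ).toNat = Q ^ (2 * N + 2) := by
    rw [← pow_add]; congr 1; omega
  -- The exponents fail to add up only at k = -(N+1), where `toNat` truncates -1 to 0; there the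
  -- second factor is 1 - Q⁰ = 0. `hB` is the mirror image.
  have hA : (Q ^ (N + 1 - k : ℤ).toNat * Q ^ (N + k : ℤ).toNat - Q ^ (2 * N + 1)) *
      (1 - Q ^ (N + 1 + k : ℤ).toNat) = 0 := by
    rcases eq_or_ne k (-(N + 1)) with rfl | h
    · simp
    · rw [← pow_add, show (N + 1 - k : ℤ).toNat + (N + k : ℤ).toNat = 2 * N + 1 by omega]
      simp
  have hB : (Q ^ (N + 1 + k : ℤ).toNat * Q ^ (N - k : ℤ).toNat - Q ^ (2 * N + 1)) *
      (1 - Q ^ (N + 1 - k : ℤ).toNat) = 0 := by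
    rcases eq_or_ne k (N + 1) with rfl | h
    · simp
    · rw [← pow_add, show (N + 1 + k : ℤ).toNat + (N - k : ℤ).toNat = 2 * N + 1 by omega]
      simp
  rw [show (N : ℤ) + 1 - k - 1 = N - k by ring] at a1
  rw [show (N : ℤ) + 1 + k - 1 = N + k by ring] at b1
  rw [a1] at a2
  rw [b1] at b2
  simp only [centralGauss, show 2 * (N + 1) = 2 * N + 1 + 1 by ring, Finset.prod_range_succ]
  push_cast
  rw [show (N : ℤ) - (k - 1) = N + 1 - k by ring, show (N : ℤ) - (k + 1) = N - k - 1 by ring,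
    show (N : ℤ) + (k - 1) = N + k - 1 by ring, show (N : ℤ) + (k + 1) = N + 1 + k by ring,
    a1, a2, b1, b2]
  generalize recipPoch g ((N : ℤ) + 1 - k) = α at *
  generalize recipPoch g ((N : ℤ) + 1 + k) = β at *
  generalize Q ^ (N + 1 - k : ℤ).toNat = A at *
  generalize Q ^ (N + 1 + k : ℤ).toNat = B at *
  generalize Q ^ (N - k : ℤ).toNat = A' at *
  generalize Q ^ (N + k : ℤ).toNat = B' at *
  generalize ∏ i ∈ Finset.range (2 * N), (1 - Q ^ (i + 1)) = q
  rw [show 2 * N + 1 + 1 = 2 * N + 2 by ring]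
  generalize Q ^ (2 * N + 1) = W at *
  rw [← hAB]
  linear_combination q * α * β * (hA + hB)

/-- Here x k plays the role of a^(k(k+1)/2) b^(k(k-1)/2). The hypotheses `hxa` and `hxb` encode the
ratio of consecutive terms, multiplied through so that no negative power of Q occurs. Induction on N
then follows the recurrence of `centralGauss_succ`. -/
theorem finite_tripleProduct {Q a b : R} (hab : a * b = Q) {g : ℕ → R}
    (hg : ∀ i, g i * (1 - Q ^ (i + 1)) = 1) {x : ℤ → R} (hx0 : x 0 = 1)
    (hxa : ∀ (N : ℕ) (k : ℤ), k ≤ N + 1 →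
      a * Q ^ N * x (k - 1) = Q ^ (N + 1 - k : ℤ).toNat * x k)
    (hxb : ∀ (N : ℕ) (k : ℤ), -(N + 1) ≤ k →
      b * Q ^ N * x (k + 1) = Q ^ (N + 1 + k : ℤ).toNat * x k) (N : ℕ) :
    (∏ i ∈ Finset.range N, (1 + a * Q ^ i)) * (∏ i ∈ Finset.range N, (1 + b * Q ^ i)) =
      ∑ k ∈ Finset.Icc (-N : ℤ) N, centralGauss Q g N k * x k := by
  induction N with
  | zero => simp [centralGauss, recipPoch, hx0]
  | succ N ih =>
    have ext (y : ℤ → R) : ∑ k ∈ Finset.Icc (-N : ℤ) N, centralGauss Q g N k * y k =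
        ∑ k ∈ Finset.Icc (-(N + 1) : ℤ) (N + 1), centralGauss Q g N k * y k := by
      refine Finset.sum_subset (fun k hk => ?_) fun k _ hk => ?_
      · rw [Finset.mem_Icc] at *; omega
      · rw [Finset.mem_Icc] at hk
        rw [centralGauss_of_lt _ _ (by omega), zero_mul]
    have ea : a * Q ^ N * ∑ k ∈ Finset.Icc (-N : ℤ) N, centralGauss Q g N k * x k =
        ∑ k ∈ Finset.Icc (-(N + 1) : ℤ) (N + 1),
          Q ^ (N + 1 - k : ℤ).toNat * centralGauss Q g N (k - 1) * x k := by
      rw [Finset.mul_sum]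
      trans ∑ k ∈ Finset.Icc (-N + 1 : ℤ) (N + 1),
          Q ^ (N + 1 - k : ℤ).toNat * centralGauss Q g N (k - 1) * x k
      · refine Finset.sum_nbij' (· + 1) (· - 1) ?_ ?_ (by simp) (by simp) fun k hk => ?_
        · intro k hk; rw [Finset.mem_Icc] at *; omega
        · intro k hk; rw [Finset.mem_Icc] at *; omega
        · rw [Finset.mem_Icc] at hk
          have := hxa N (k + 1) (by omega)
          rw [add_sub_cancel_right] at this ⊢
          linear_combination centralGauss Q g N k * this
      · refine Finset.sum_subset (fun k hk => ?_) fun k _ hk => ?_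
        · rw [Finset.mem_Icc] at *; omega
        · rw [Finset.mem_Icc] at *
          rw [centralGauss_of_lt _ _ (by omega), mul_zero, zero_mul]
    have eb : b * Q ^ N * ∑ k ∈ Finset.Icc (-N : ℤ) N, centralGauss Q g N k * x k =
        ∑ k ∈ Finset.Icc (-(N + 1) : ℤ) (N + 1),
          Q ^ (N + 1 + k : ℤ).toNat * centralGauss Q g N (k + 1) * x k := by
      rw [Finset.mul_sum]
      trans ∑ k ∈ Finset.Icc (-(N + 1) : ℤ) (N - 1),
          Q ^ (N + 1 + k : ℤ).toNat * centralGauss Q g N (k + 1) * x k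
      · refine Finset.sum_nbij' (· - 1) (· + 1) ?_ ?_ (by simp) (by simp) fun k hk => ?_
        · intro k hk; rw [Finset.mem_Icc] at *; omega
        · intro k hk; rw [Finset.mem_Icc] at *; omega
        · rw [Finset.mem_Icc] at hk
          have := hxb N (k - 1) (by omega)
          rw [sub_add_cancel] at this ⊢
          linear_combination centralGauss Q g N k * this
      · refine Finset.sum_subset (fun k hk => ?_) fun k _ hk => ?_
        · rw [Finset.mem_Icc] at *; omega
        · rw [Finset.mem_Icc] at *
          rw [centralGauss_of_lt _ _ (by omega), mul_zero, zero_mul]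
    have e0 : (1 + Q ^ (2 * N + 1)) * ∑ k ∈ Finset.Icc (-N : ℤ) N, centralGauss Q g N k * x k =
        ∑ k ∈ Finset.Icc (-(N + 1) : ℤ) (N + 1),
          (1 + Q ^ (2 * N + 1)) * centralGauss Q g N k * x k := by
      rw [ext, Finset.mul_sum]
      exact Finset.sum_congr rfl fun k _ => by ring
    push_cast
    rw [Finset.prod_range_succ, Finset.prod_range_succ]
    trans (1 + Q ^ (2 * N + 1)) * ∑ k ∈ Finset.Icc (-N : ℤ) N, centralGauss Q g N k * x k +
      a * Q ^ N * ∑ k ∈ Finset.Icc (-N : ℤ) N, centralGauss Q g N k * x k +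
      b * Q ^ N * ∑ k ∈ Finset.Icc (-N : ℤ) N, centralGauss Q g N k * x k
    · rw [← ih]
      have hQ : Q ^ (2 * N + 1) = a * b * Q ^ N * Q ^ N := by rw [hab]; ring
      rw [hQ]
      ring
    · rw [e0, ea, eb, ← Finset.sum_add_distrib, ← Finset.sum_add_distrib]
      refine Finset.sum_congr rfl fun k hk => ?_
      rw [centralGauss_succ hg hk]
      ring

end FiniteIdentity

/-! ### The Jacobi triple product -/

theorem unitsInt_cast_mul_self (s : ℤˣ) :
    ((s : ℤ) : PowerSeries ℤ) * ((s : ℤ) : PowerSeries ℤ) = 1 := by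
  rw [← Int.cast_mul, ← Units.val_mul, Int.units_mul_self]; simp

/-- Let N tend to infinity in the finite identity with a = s q^u and b = s q^v: every central
Gaussian coefficient tends to G = 1/∏(1 - Q^n). -/
theorem theta_eq_pochProd (s : ℤˣ) {u v : ℕ} (hu : 0 < u) (hv : 0 < v) :
    theta s u v =
      pochProd s (u + v) u * pochProd s (u + v) v * pochProd (-1) (u + v) (u + v) := by
  set Q : PowerSeries ℤ := X ^ (u + v) with hQ
  set σ : PowerSeries ℤ := ((s : ℤ) : PowerSeries ℤ) with hσ
  have hσσ : σ * σ = 1 := unitsInt_cast_mul_self s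
  set x : ℤ → PowerSeries ℤ := fun k => (((s ^ k : ℤˣ) : ℤ) : PowerSeries ℤ) *
    X ^ (u * triangular k + v * triangular (-k)) with hx
  set g : ℕ → PowerSeries ℤ := fun i => invOfUnit (1 - Q ^ (i + 1)) 1
  have hg : ∀ i, g i * (1 - Q ^ (i + 1)) = 1 := fun i =>
    invOfUnit_mul _ _ (by simp [hQ, show u ≠ 0 by omega])
  have hsk (k : ℤ) : σ * (((s ^ k : ℤˣ) : ℤ) : PowerSeries ℤ) =
      (((s ^ (k + 1) : ℤˣ) : ℤ) : PowerSeries ℤ) := by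
    rw [hσ, ← Int.cast_mul, ← Units.val_mul, zpow_add_one, mul_comm]
  have tri1 (k : ℤ) : (triangular (k + 1) : ℤ) = triangular k + k + 1 := by
    have := two_mul_triangular k
    have := two_mul_triangular (k + 1)
    linarith
  have tri2 (k : ℤ) : (triangular (-(k + 1)) : ℤ) = triangular (-k) + k := by
    have := two_mul_triangular (-k)
    have := two_mul_triangular (-(k + 1))
    linarith
  have hxa (N : ℕ) (k : ℤ) (hk : k ≤ N + 1) :
      σ * X ^ u * Q ^ N * x (k - 1) = Q ^ (N + 1 - k : ℤ).toNat * x k := by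
    have h := hsk (k - 1)
    rw [sub_add_cancel] at h
    simp only [hx]
    rw [← h, hQ, ← pow_mul, ← pow_mul]
    have he : u + (u + v) * N + (u * triangular (k - 1) + v * triangular (-(k - 1))) =
        (u + v) * (N + 1 - k : ℤ).toNat + (u * triangular k + v * triangular (-k)) := by
      have t1 := tri1 (k - 1)
      have t2 := tri2 (k - 1)
      rw [sub_add_cancel] at t1 t2
      zify
      rw [Int.toNat_of_nonneg (by omega), t1, t2]
      ring
    calc _ = σ * (((s ^ (k - 1) : ℤˣ) : ℤ) : PowerSeries ℤ) *
          X ^ (u + (u + v) * N + (u * triangular (k - 1) + v * triangular (-(k - 1)))) := by ring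
      _ = _ := by rw [he]; ring
  have hxb (N : ℕ) (k : ℤ) (hk : -(N + 1) ≤ k) :
      σ * X ^ v * Q ^ N * x (k + 1) = Q ^ (N + 1 + k : ℤ).toNat * x k := by
    have h := hsk k
    simp only [hx]
    rw [← h, hQ, ← pow_mul, ← pow_mul]
    have he : v + (u + v) * N + (u * triangular (k + 1) + v * triangular (-(k + 1))) =
        (u + v) * (N + 1 + k : ℤ).toNat + (u * triangular k + v * triangular (-k)) := by
      zify
      rw [Int.toNat_of_nonneg (by omega), tri1, tri2]
      ring
    calc _ = σ * σ * (((s ^ k : ℤˣ) : ℤ) : PowerSeries ℤ) *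
          X ^ (v + (u + v) * N + (u * triangular (k + 1) + v * triangular (-(k + 1)))) := by ring
      _ = _ := by rw [he, hσσ]; ring
  have fin := finite_tripleProduct (R := PowerSeries ℤ) (Q := Q) (a := σ * X ^ u) (b := σ * X ^ v)
    (by rw [hQ]; linear_combination X ^ (u + v) * hσσ) hg (x := x)
    (by simp [hx, triangular]) hxa hxb
  have hw : 0 < u + v := by omega
  have pt (s' : ℤˣ) (r : ℕ) : Tendsto (fun N => ∏ i ∈ Finset.range N,
      (1 + ((s' : ℤ) : PowerSeries ℤ) * X ^ r * Q ^ i)) atTop (𝓝 (pochProd s' (u + v) r)) := by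
    refine (multipliable_pochProd s' hw r).tendsto_prod_tprod_nat.congr fun N => ?_
    refine Finset.prod_congr rfl fun i _ => ?_
    rw [hQ, ← pow_mul, pow_add]; ring
  have pE : Tendsto (fun N => ∏ i ∈ Finset.range N, (1 - Q ^ (i + 1))) atTop
      (𝓝 (pochProd (-1) (u + v) (u + v))) := by
    refine (pt (-1) (u + v)).congr fun N => Finset.prod_congr rfl fun i _ => ?_
    rw [hQ]; push_cast; ring
  -- The relation g n (1 - Q^(n+1)) = 1 reads g n = 1 + Q^(n+1) g n, so the factors tend to 1.
  have gm : Multipliable g := by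
    have : g = fun n => 1 + Q ^ (n + 1) * g n := by
      funext n
      linear_combination hg n
    rw [this]
    refine multipliable_one_add_of_X_pow_dvd _ fun n => dvd_mul_of_dvd_left ?_ _
    rw [hQ, ← pow_mul]
    exact pow_dvd_pow X (by nlinarith)
  set G := ∏' n, g n
  have pG : Tendsto (fun N => ∏ i ∈ Finset.range N, g i) atTop (𝓝 G) := gm.tendsto_prod_tprod_nat
  have hEG : pochProd (-1) (u + v) (u + v) * G = 1 := by
    refine tendsto_nhds_unique (pE.mul pG) (tendsto_const_nhds.congr fun N => ?_)
    rw [← Finset.prod_mul_distrib]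
    exact (Finset.prod_eq_one fun i _ => by rw [mul_comm, hg]).symm
  have rG (k : ℤ) : Tendsto (fun N : ℕ => recipPoch g (N + k)) atTop (𝓝 G) := by
    have : Tendsto (fun N : ℕ => ((N : ℤ) + k).toNat) atTop atTop := by
      refine tendsto_atTop.mpr fun b => ?_
      filter_upwards [eventually_ge_atTop (b + k.natAbs)] with N hN
      omega
    refine (pG.comp this).congr' ?_
    filter_upwards [eventually_ge_atTop k.natAbs] with N hN
    rw [recipPoch, if_neg (by omega)]
    rfl
  have cG (k : ℤ) : Tendsto (fun N : ℕ => centralGauss Q g N k) atTop (𝓝 G) := by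
    have h2 : Tendsto (fun N : ℕ => 2 * N) atTop atTop :=
      tendsto_atTop.mpr fun b => by
        filter_upwards [eventually_ge_atTop b] with N hN
        omega
    have := ((pE.comp h2).mul (rG (-k))).mul (rG k)
    rw [hEG, one_mul] at this
    exact this
  have small (c : PowerSeries ℤ) {n : ℕ} {k : ℤ} (hk : k ∉ Finset.Icc (-n : ℤ) n) :
      coeff n (c * x k) = 0 := by
    have : X ^ (u * triangular k + v * triangular (-k)) ∣ c * x k :=
      dvd_mul_of_dvd_right (dvd_mul_left _ _) _
    refine X_pow_dvd_iff.mp this n ?_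
    have := natAbs_le_triangular_add k hu hv
    rw [Finset.mem_Icc] at hk
    omega
  -- The limit may be taken inside the sum: the coefficient of qⁿ involves only |k| ≤ n.
  have key : pochProd s (u + v) u * pochProd s (u + v) v = G * theta s u v := by
    refine tendsto_nhds_unique ((pt s u).mul (pt s v)) ?_
    rw [WithPiTopology.tendsto_iff_coeff_tendsto]
    intro n
    have h1 := (hasSum_theta s hu hv).mul_left G
    have h2 : coeff n (G * theta s u v) = ∑ k ∈ Finset.Icc (-n : ℤ) n, coeff n (G * x k) :=
      ((WithPiTopology.hasSum_iff_hasSum_coeff ℤ).mp h1 n).unique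
        (hasSum_sum_of_ne_finset_zero fun k hk => small G hk)
    rw [h2]
    have h3 : Tendsto (fun N : ℕ => ∑ k ∈ Finset.Icc (-n : ℤ) n,
        coeff n (centralGauss Q g N k * x k)) atTop
        (𝓝 (∑ k ∈ Finset.Icc (-n : ℤ) n, coeff n (G * x k))) :=
      tendsto_finsetSum _ fun k _ => ((WithPiTopology.continuous_coeff ℤ n).tendsto _).comp
        ((cG k).mul tendsto_const_nhds)
    refine h3.congr' ?_
    filter_upwards [eventually_ge_atTop n] with N hN
    rw [fin N, map_sum]
    refine Finset.sum_subset (fun k hk => ?_) fun k _ hk => small _ hk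
    rw [Finset.mem_Icc] at *
    omega
  linear_combination (-theta s u v) * hEG - pochProd (-1) (u + v) (u + v) * key

/-! ### Splitting q-products by residue class -/

theorem pochProd_two_split (s : ℤˣ) {m : ℕ} (hm : 0 < m) (r : ℕ) :
    pochProd s m r = pochProd s (2 * m) r * pochProd s (2 * m) (r + m) := by
  have t (r' : ℕ) := (multipliable_pochProd s (m := 2 * m) (by omega) r').tendsto_prod_tprod_nat
  have h2 : Tendsto (fun N : ℕ => 2 * N) atTop atTop :=
    tendsto_atTop.mpr fun b => by
      filter_upwards [eventually_ge_atTop b] with N hN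
      omega
  refine tendsto_nhds_unique ((multipliable_pochProd s hm r).tendsto_prod_tprod_nat.comp h2)
    (((t r).mul (t (r + m))).congr fun N => ?_)
  induction N with
  | zero => simp
  | succ N ih =>
    simp only [Function.comp_apply, mul_add, mul_one, Finset.prod_range_succ] at ih ⊢
    rw [← ih]
    ring_nf

theorem pochProd_three_split (s : ℤˣ) {m : ℕ} (hm : 0 < m) (r : ℕ) :
    pochProd s m r =
      pochProd s (3 * m) r * pochProd s (3 * m) (r + m) * pochProd s (3 * m) (r + 2 * m) := by
  have t (r' : ℕ) := (multipliable_pochProd s (m := 3 * m) (by omega) r').tendsto_prod_tprod_nat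
  have h2 : Tendsto (fun N : ℕ => 3 * N) atTop atTop :=
    tendsto_atTop.mpr fun b => by
      filter_upwards [eventually_ge_atTop b] with N hN
      omega
  refine tendsto_nhds_unique ((multipliable_pochProd s hm r).tendsto_prod_tprod_nat.comp h2)
    ((((t r).mul (t (r + m))).mul (t (r + 2 * m))).congr fun N => ?_)
  induction N with
  | zero => simp
  | succ N ih =>
    simp only [Function.comp_apply, mul_add, mul_one, Finset.prod_range_succ] at ih ⊢
    rw [← ih]
    ring_nf

theorem pochProd_one_mul_neg_one {m : ℕ} (hm : 0 < m) (r : ℕ) :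
    pochProd 1 m r * pochProd (-1) m r = pochProd (-1) (2 * m) (2 * r) := by
  refine tendsto_nhds_unique
    ((multipliable_pochProd 1 hm r).tendsto_prod_tprod_nat.mul
      (multipliable_pochProd (-1) hm r).tendsto_prod_tprod_nat)
    ((multipliable_pochProd (-1) (m := 2 * m) (by omega) (2 * r)).tendsto_prod_tprod_nat.congr
      fun N => ?_)
  rw [← Finset.prod_mul_distrib]
  refine Finset.prod_congr rfl fun i _ => ?_
  push_cast
  ring

theorem constantCoeff_pochProd (s : ℤˣ) {m r : ℕ} (hm : 0 < m) (hr : 0 < r) :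
    constantCoeff (pochProd s m r) = 1 := by
  have h := ((WithPiTopology.continuous_constantCoeff ℤ).tendsto _).comp
    (multipliable_pochProd s hm r).tendsto_prod_tprod_nat
  refine tendsto_nhds_unique h (tendsto_const_nhds.congr fun N => ?_)
  simp only [Function.comp_apply, map_prod]
  exact (Finset.prod_eq_one fun i _ => by simp [hr.ne']).symm

theorem pochProd_ne_zero (s : ℤˣ) {m r : ℕ} (hm : 0 < m) (hr : 0 < r) : pochProd s m r ≠ 0 := by
  intro h
  simpa [h] using constantCoeff_pochProd s hm hr

/-! ### The theta functions used and their eta quotients -/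

/-- `φ(q^k)`. -/
noncomputable def phi (k : ℕ) : PowerSeries ℤ := theta 1 k k

/-- `φ(-q^k)`. -/
noncomputable def phiNeg (k : ℕ) : PowerSeries ℤ := theta (-1) k k

/-- `ψ(q^k)`. -/
noncomputable def psi (k : ℕ) : PowerSeries ℤ := theta 1 k (3 * k)

/-- `∑ (-1)ⁿ q^(k (3n² - 2n))`. -/
noncomputable def omegaNeg (k : ℕ) : PowerSeries ℤ := theta (-1) k (5 * k)

/-- `∑ q^(k n(3n - 1)/2)`. -/
noncomputable def pent (k : ℕ) : PowerSeries ℤ := theta 1 k (2 * k)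

/-- The Euler function `∏ (1 - q^(k n))`, as the series `∑ (-1)ⁿ q^(k n(3n - 1)/2)`. -/
noncomputable def euler (k : ℕ) : PowerSeries ℤ := theta (-1) k (2 * k)

section Products

variable {k : ℕ}

/-- Euler's pentagonal number theorem: the three factors of the triple product are the residue
classes modulo 3 of one product. -/
theorem euler_eq (hk : 0 < k) : euler k = pochProd (-1) k k := by
  rw [euler, theta_eq_pochProd _ hk (by omega), pochProd_three_split (-1) hk,
    show k + 2 * k = 3 * k by ring, show k + k = 2 * k by ring]

theorem euler_ne_zero (hk : 0 < k) : euler k ≠ 0 := by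
  rw [euler_eq hk]; exact pochProd_ne_zero _ hk hk

theorem euler_eq_odd_mul (hk : 0 < k) : euler k = pochProd (-1) (2 * k) k * euler (2 * k) := by
  rw [euler_eq hk, euler_eq (by omega), pochProd_two_split (-1) hk, show k + k = 2 * k by ring]

theorem odd_mul_odd (hk : 0 < k) :
    pochProd 1 (2 * k) k * pochProd (-1) (2 * k) k = pochProd (-1) (2 * (2 * k)) (2 * k) :=
  pochProd_one_mul_neg_one (by omega) k

theorem phi_eq (hk : 0 < k) : phi k = pochProd 1 (2 * k) k ^ 2 * euler (2 * k) := by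
  rw [phi, theta_eq_pochProd _ hk hk, euler_eq (by omega), show k + k = 2 * k by ring]
  ring

theorem phiNeg_eq (hk : 0 < k) : phiNeg k = pochProd (-1) (2 * k) k ^ 2 * euler (2 * k) := by
  rw [phiNeg, theta_eq_pochProd _ hk hk, euler_eq (by omega), show k + k = 2 * k by ring]
  ring

theorem psi_eq (hk : 0 < k) : psi k = pochProd 1 (2 * k) k * euler (4 * k) := by
  rw [psi, theta_eq_pochProd _ hk (by omega), euler_eq (by omega),
    pochProd_two_split 1 (show 0 < 2 * k by omega), show k + 3 * k = 4 * k by ring,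
    show 2 * (2 * k) = 4 * k by ring, show k + 2 * k = 3 * k by ring]

theorem omegaNeg_mul (hk : 0 < k) :
    omegaNeg k * (euler (2 * k) * euler (3 * k)) = euler k * euler (6 * k) ^ 2 := by
  have h := pochProd_three_split (-1) (show 0 < 2 * k by omega) k
  rw [show 3 * (2 * k) = 6 * k by ring, show k + 2 * k = 3 * k by ring,
    show k + 2 * (2 * k) = 5 * k by ring] at h
  have h3 := euler_eq_odd_mul (show 0 < 3 * k by omega)
  rw [show 2 * (3 * k) = 6 * k by ring] at h3
  rw [omegaNeg, theta_eq_pochProd _ hk (by omega), euler_eq_odd_mul hk, h3, h,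
    show k + 5 * k = 6 * k by ring, ← euler_eq (k := 6 * k) (by omega)]
  ring

theorem pent_mul (hk : 0 < k) :
    pent k * (euler k * euler (6 * k)) = euler (2 * k) * euler (3 * k) ^ 2 := by
  have h := pochProd_three_split 1 hk k
  rw [show k + k = 2 * k by ring, show k + 2 * k = 3 * k by ring] at h
  have h1 := pochProd_one_mul_neg_one hk k
  have h3 := pochProd_one_mul_neg_one (show 0 < 3 * k by omega) (3 * k)
  rw [show 2 * (3 * k) = 6 * k by ring] at h3
  rw [pent, theta_eq_pochProd _ hk (by omega), euler_eq hk, euler_eq (k := 2 * k) (by omega),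
    euler_eq (k := 3 * k) (by omega), euler_eq (k := 6 * k) (by omega), ← h1, ← h3, h,
    show k + 2 * k = 3 * k by ring]
  ring

theorem psi_mul_euler (hk : 0 < k) : psi k * euler k = euler (2 * k) ^ 2 := by
  have h2 := euler_eq_odd_mul (show 0 < 2 * k by omega)
  rw [psi_eq hk, euler_eq_odd_mul hk, show 4 * k = 2 * (2 * k) by ring]
  linear_combination euler (2 * k) * (euler (2 * (2 * k)) * odd_mul_odd hk - h2)

theorem phiNeg_mul_euler (hk : 0 < k) : phiNeg k * euler (2 * k) = euler k ^ 2 := by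
  rw [phiNeg_eq hk, euler_eq_odd_mul hk]
  ring

theorem phi_mul_phiNeg (hk : 0 < k) : phi k * phiNeg k = phiNeg (2 * k) ^ 2 := by
  have h2 := euler_eq_odd_mul (show 0 < 2 * k by omega)
  rw [phi_eq hk, phiNeg_eq hk, phiNeg_eq (k := 2 * k) (by omega), h2, ← odd_mul_odd hk]
  ring

theorem psi_mul_phiNeg (hk : 0 < k) : psi k * phiNeg k = euler k * euler (2 * k) := by
  refine mul_right_cancel₀ (mul_ne_zero (euler_ne_zero hk)
    (euler_ne_zero (k := 2 * k) (by omega))) ?_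
  linear_combination phiNeg k * euler (2 * k) * psi_mul_euler hk +
    euler (2 * k) ^ 2 * phiNeg_mul_euler hk

/-- Both sides are E₃E₆ (at k = 1). This identity merges the cross terms in the 3-dissections below.
-/
theorem pent_mul_omegaNeg (hk : 0 < k) :
    pent k * omegaNeg k = psi (3 * k) * phiNeg (3 * k) := by
  have h := psi_mul_phiNeg (show 0 < 3 * k by omega)
  rw [show 2 * (3 * k) = 6 * k by ring] at h
  have n1 := euler_ne_zero hk
  have n2 := euler_ne_zero (show 0 < 2 * k by omega)
  have n3 := euler_ne_zero (show 0 < 3 * k by omega)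
  have n6 := euler_ne_zero (show 0 < 6 * k by omega)
  rw [h]
  refine mul_right_cancel₀ (mul_ne_zero (mul_ne_zero n1 n6) (mul_ne_zero n2 n3)) ?_
  linear_combination omegaNeg k * (euler (2 * k) * euler (3 * k)) * pent_mul hk +
    euler (2 * k) * euler (3 * k) ^ 2 * omegaNeg_mul hk

/-- The factors E₁ and E₃ cancel, leaving a series in q^(2k); this parity drives the congruences
modulo 24 and 16. -/
theorem psi_psi_phiNeg_omegaNeg (hk : 0 < k) :
    psi k * psi (3 * k) * phiNeg (3 * k) * omegaNeg k = euler (2 * k) * euler (6 * k) ^ 3 := by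
  have h := psi_mul_phiNeg (show 0 < 3 * k by omega)
  rw [show 2 * (3 * k) = 6 * k by ring] at h
  have n1 := euler_ne_zero hk
  have n2 := euler_ne_zero (show 0 < 2 * k by omega)
  have n3 := euler_ne_zero (show 0 < 3 * k by omega)
  refine mul_right_cancel₀ (mul_ne_zero n1 (mul_ne_zero n2 n3)) ?_
  linear_combination psi k * omegaNeg k * (euler k * (euler (2 * k) * euler (3 * k))) * h +
    (euler (3 * k) * euler (6 * k)) *
      (omegaNeg k * (euler (2 * k) * euler (3 * k)) * psi_mul_euler hk +
        euler (2 * k) ^ 2 * omegaNeg_mul hk)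

theorem schurOverGenFun_mul_odd {t : ℕ} (ht : 1 ≤ t) :
    schurOverGenFun t * (pochProd 1 (2 * t) t * pochProd (-1) 2 1) =
      pochProd 1 2 1 * pochProd (-1) (2 * t) t := by
  have m (s : ℤˣ) := multipliable_pochProd s (show 0 < 2 by omega) 1
  have mt (s : ℤˣ) := multipliable_pochProd s (show 0 < 2 * t by omega) t
  refine tendsto_nhds_unique
    ((multipliable_schurOverFactor ht).tendsto_prod_tprod_nat.mul
      ((mt 1).tendsto_prod_tprod_nat.mul (m (-1)).tendsto_prod_tprod_nat))
    (((m 1).tendsto_prod_tprod_nat.mul (mt (-1)).tendsto_prod_tprod_nat).congr fun N => ?_)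
  simp only [← Finset.prod_mul_distrib]
  refine Finset.prod_congr rfl fun i _ => ?_
  have := schurOverFactor_mul ht i
  rw [show 2 * t * i + t = t * (2 * i + 1) by ring]
  push_cast
  linear_combination -this

/-- The generating function as a quotient of theta functions. -/
theorem schurOverGenFun_three_mul :
    schurOverGenFun 3 * (phiNeg 2 * phi 3) = phi 1 * phiNeg 6 := by
  have h := schurOverGenFun_mul_odd (t := 3) (by omega)
  have e1 := euler_eq_odd_mul (k := 2) (by omega)
  have e2 := euler_eq_odd_mul (k := 6) (by omega)
  have o1 := odd_mul_odd (k := 1) (by omega)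
  have o3 := odd_mul_odd (k := 3) (by omega)
  rw [phiNeg_eq (by omega), phi_eq (by omega), phi_eq (by omega), phiNeg_eq (by omega)]
  norm_num at *
  rw [e1, e2, ← o1, ← o3]
  linear_combination pochProd 1 2 1 ^ 2 * pochProd (-1) 2 1 * pochProd 1 6 3 ^ 2 *
    pochProd (-1) 6 3 * euler 4 * euler 12 * h

end Products

/-! ### Splitting sums over ℤ by residue class -/

section Sums

theorem hasSum_of_eq {ι M : Type*} [AddCommMonoid M] [TopologicalSpace M] {f g : ι → M} {a : M}
    (h : HasSum f a) (e : ∀ i, g i = f i) : HasSum g a :=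
  (funext e : g = f) ▸ h

variable {M : Type*} [AddCommMonoid M] [TopologicalSpace M]

theorem hasSum_ite_progression {f : ℤ → M} {a : M} {m : ℤ} (hm : m ≠ 0) (c : ℤ)
    (h : HasSum (fun j => f (m * j + c)) a) :
    HasSum (fun k => if (k - c) % m = 0 then f k else 0) a := by
  have inj : Function.Injective fun j : ℤ => m * j + c := fun i j hij =>
    mul_left_cancel₀ hm (add_right_cancel hij)
  refine (inj.hasSum_iff fun k hk => if_neg fun h0 => hk ?_).mp ?_
  · obtain ⟨j, hj⟩ := Int.dvd_of_emod_eq_zero h0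
    exact ⟨j, show m * j + c = k by omega⟩
  · convert h using 2 with j
    simp

theorem hasSum_int_mod_two [ContinuousAdd M] {f : ℤ → M} {a b : M} (c : ℤ) (hc : c % 2 = 1)
    (h0 : HasSum (fun j => f (2 * j)) a) (h1 : HasSum (fun j => f (2 * j + c)) b) :
    HasSum f (a + b) := by
  convert (hasSum_ite_progression two_ne_zero 0 (by simpa using h0)).add
    (hasSum_ite_progression two_ne_zero c h1) using 2 with k
  rcases Int.emod_two_eq_zero_or_one k with h | h
  · rw [if_pos (by omega), if_neg (by omega), add_zero]
  · rw [if_neg (by omega), if_pos (by omega), zero_add]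

theorem hasSum_int_mod_three [ContinuousAdd M] {f : ℤ → M} {a b c : M}
    (h0 : HasSum (fun j => f (3 * j)) a) (h1 : HasSum (fun j => f (3 * j + 1)) b)
    (h2 : HasSum (fun j => f (3 * j + -1)) c) :
    HasSum f (a + b + c) := by
  convert ((hasSum_ite_progression three_ne_zero 0 (by simpa using h0)).add
    (hasSum_ite_progression three_ne_zero 1 h1)).add
    (hasSum_ite_progression three_ne_zero (-1) h2) using 2 with k
  have : k % 3 = 0 ∨ k % 3 = 1 ∨ k % 3 = 2 := by omega
  rcases this with h | h | h
  · rw [if_pos (by omega), if_neg (by omega), if_neg (by omega), add_zero, add_zero]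
  · rw [if_neg (by omega), if_pos (by omega), if_neg (by omega), add_zero, zero_add]
  · rw [if_neg (by omega), if_neg (by omega), if_pos (by omega), add_zero, zero_add]

end Sums

/-! ### Dissections of theta functions modulo 2 and 3 -/

section Dissections

variable {k : ℕ}

/-- Doubling clears the halves in triangular numbers, so exponent identities become linear
combinations of `two_mul_triangular`. -/
theorem X_pow_congr_of_two_mul {a b : ℕ} (h : (2 : ℤ) * a = 2 * b) :
    (X : PowerSeries ℤ) ^ a = X ^ b := by
  congr 1; omega

theorem hasSum_phi (hk : 0 < k) :
    HasSum (fun j : ℤ => (X : PowerSeries ℤ) ^ (k * j.natAbs ^ 2)) (phi k) := by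
  refine hasSum_of_eq (hasSum_theta 1 hk hk) fun j => ?_
  simp only [one_zpow, Units.val_one, Int.cast_one, one_mul]
  refine X_pow_congr_of_two_mul ?_
  push_cast
  rw [sq_abs]
  linear_combination (-k : ℤ) * two_mul_triangular j - k * two_mul_triangular (-j)

theorem hasSum_phiNeg (hk : 0 < k) :
    HasSum (fun j : ℤ => ((((-1) ^ j : ℤˣ) : ℤ) : PowerSeries ℤ) * X ^ (k * j.natAbs ^ 2))
      (phiNeg k) := by
  refine hasSum_of_eq (hasSum_theta (-1) hk hk) fun j => congrArg _ ?_
  refine X_pow_congr_of_two_mul ?_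
  push_cast
  rw [sq_abs]
  linear_combination (-k : ℤ) * two_mul_triangular j - k * two_mul_triangular (-j)

theorem hasSum_psi (hk : 0 < k) :
    HasSum (fun j : ℤ => (X : PowerSeries ℤ) ^ (k * triangular j + 3 * k * triangular (-j)))
      (psi k) := by
  exact hasSum_of_eq (hasSum_theta 1 hk (show 0 < 3 * k by omega)) fun j => by simp

/-- Over all of ℤ each triangular number occurs twice; the even and the odd indices each reproduce
ψ. -/
theorem hasSum_two_psi (hk : 0 < k) :
    HasSum (fun j : ℤ => (X : PowerSeries ℤ) ^ (k * triangular j)) (2 * psi k) := by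
  rw [two_mul]
  refine hasSum_int_mod_two (-1) rfl ?_ ?_
  · rw [← (Equiv.neg ℤ).hasSum_iff]
    refine hasSum_of_eq (hasSum_psi hk) fun j => ?_
    refine X_pow_congr_of_two_mul ?_
    simp only [Equiv.neg_apply]
    push_cast
    linear_combination (k : ℤ) * two_mul_triangular (2 * -j) - k * two_mul_triangular j -
      3 * k * two_mul_triangular (-j)
  · refine hasSum_of_eq (hasSum_psi hk) fun j => ?_
    refine X_pow_congr_of_two_mul ?_
    push_cast
    linear_combination (k : ℤ) * two_mul_triangular (2 * j + -1) - k * two_mul_triangular j -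
      3 * k * two_mul_triangular (-j)

theorem hasSum_phi_odd_part (hk : 0 < k) :
    HasSum (fun j : ℤ => (X : PowerSeries ℤ) ^ (k * (2 * j + 1).natAbs ^ 2))
      (X ^ k * (2 * psi (8 * k))) := by
  refine hasSum_of_eq ((hasSum_two_psi (show 0 < 8 * k by omega)).mul_left (X ^ k)) fun j => ?_
  rw [← pow_add]
  refine X_pow_congr_of_two_mul ?_
  push_cast
  rw [sq_abs]
  linear_combination (-8 * k : ℤ) * two_mul_triangular j

theorem phi_two_dissection (hk : 0 < k) : phi k = phi (4 * k) + 2 * X ^ k * psi (8 * k) := by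
  refine (hasSum_phi hk).unique ?_
  rw [show 2 * X ^ k * psi (8 * k) = X ^ k * (2 * psi (8 * k)) by ring]
  refine hasSum_int_mod_two 1 rfl ?_ (hasSum_phi_odd_part hk)
  refine hasSum_of_eq (hasSum_phi (show 0 < 4 * k by omega)) fun j => ?_
  refine X_pow_congr_of_two_mul ?_
  push_cast
  simp only [sq_abs]
  ring

theorem phiNeg_two_dissection (hk : 0 < k) :
    phiNeg k = phi (4 * k) - 2 * X ^ k * psi (8 * k) := by
  refine (hasSum_phiNeg hk).unique ?_
  rw [show phi (4 * k) - 2 * X ^ k * psi (8 * k) = phi (4 * k) + -(X ^ k * (2 * psi (8 * k))) by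
    ring]
  refine hasSum_int_mod_two 1 rfl ?_ ?_
  · refine hasSum_of_eq (hasSum_phi (show 0 < 4 * k by omega)) fun j => ?_
    rw [zpow_mul]
    simp only [zpow_ofNat, even_two, Even.neg_pow, one_pow, one_zpow, Units.val_one, Int.cast_one,
      one_mul]
    refine X_pow_congr_of_two_mul ?_
    push_cast
    simp only [sq_abs]
    ring
  · refine hasSum_of_eq (hasSum_phi_odd_part hk).neg fun j => ?_
    rw [zpow_add_one, zpow_mul]
    simp

theorem psi_three_dissection (hk : 0 < k) : psi k = pent (3 * k) + X ^ k * psi (9 * k) := by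
  have h := hasSum_psi hk
  have s0 : Summable fun j : ℤ =>
      (X : PowerSeries ℤ) ^ (k * triangular (3 * j) + 3 * k * triangular (-(3 * j))) :=
    h.summable.comp_injective (i := fun j : ℤ => 3 * j) fun a b hab => by simpa using hab
  have s2 : Summable fun j : ℤ =>
      (X : PowerSeries ℤ) ^ (k * triangular (3 * j + -1) + 3 * k * triangular (-(3 * j + -1))) :=
    h.summable.comp_injective (i := fun j : ℤ => 3 * j + -1) fun a b hab => by simpa using hab
  have s1 : HasSum (fun j : ℤ =>
      (X : PowerSeries ℤ) ^ (k * triangular (3 * j + 1) + 3 * k * triangular (-(3 * j + 1))))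
      (X ^ k * psi (9 * k)) := by
    rw [← (Equiv.neg ℤ).hasSum_iff]
    refine hasSum_of_eq ((hasSum_psi (show 0 < 9 * k by omega)).mul_left (X ^ k)) fun j => ?_
    rw [← pow_add]
    refine X_pow_congr_of_two_mul ?_
    simp only [Equiv.neg_apply]
    push_cast
    linear_combination (k : ℤ) * two_mul_triangular (3 * -j + 1) +
      3 * k * two_mul_triangular (-(3 * -j + 1)) - 9 * k * two_mul_triangular j -
      27 * k * two_mul_triangular (-j)
  obtain ⟨y, hy⟩ := s0
  obtain ⟨y', hy'⟩ := s2
  have e1 := h.unique (hasSum_int_mod_three hy s1 hy')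
  -- The classes 0 and -1 modulo 3 of the ψ series are the even and odd indices of the pentagonal
  -- series.
  have e2 : pent (3 * k) = y + y' := by
    refine HasSum.unique (f := fun j : ℤ => (X : PowerSeries ℤ) ^
      (3 * k * triangular j + 6 * k * triangular (-j))) ?_ (hasSum_int_mod_two 1 rfl ?_ ?_)
    · refine hasSum_of_eq (hasSum_theta 1 (show 0 < 3 * k by omega)
        (show 0 < 2 * (3 * k) by omega)) fun j => ?_
      simp only [one_zpow, Units.val_one, Int.cast_one, one_mul]
      ring_nf
    · refine hasSum_of_eq hy fun j => ?_
      refine X_pow_congr_of_two_mul ?_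
      push_cast
      linear_combination (3 * k : ℤ) * two_mul_triangular (2 * j) +
        6 * k * two_mul_triangular (-(2 * j)) - k * two_mul_triangular (3 * j) -
        3 * k * two_mul_triangular (-(3 * j))
    · rw [← (Equiv.neg ℤ).hasSum_iff]
      refine hasSum_of_eq hy' fun j => ?_
      refine X_pow_congr_of_two_mul ?_
      simp only [Equiv.neg_apply]
      push_cast
      linear_combination (3 * k : ℤ) * two_mul_triangular (2 * -j + 1) +
        6 * k * two_mul_triangular (-(2 * -j + 1)) - k * two_mul_triangular (3 * j + -1) -
        3 * k * two_mul_triangular (-(3 * j + -1))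
  rw [e1, e2]
  ring

/-- The indices divisible by 3 give φ(-q⁹), and the classes ±1 contribute equally by the symmetry j
↦ -j. -/
theorem phiNeg_three_dissection (hk : 0 < k) :
    phiNeg k = phiNeg (9 * k) - 2 * X ^ k * omegaNeg (3 * k) := by
  have h1 := (hasSum_theta (-1) (show 0 < 3 * k by omega)
    (show 0 < 5 * (3 * k) by omega)).mul_left (-X ^ k)
  refine (hasSum_phiNeg hk).unique ?_
  rw [show phiNeg (9 * k) - 2 * X ^ k * omegaNeg (3 * k) =
    phiNeg (9 * k) + -X ^ k * omegaNeg (3 * k) + -X ^ k * omegaNeg (3 * k) by ring]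
  refine hasSum_int_mod_three ?_ ?_ ?_
  · refine hasSum_of_eq (hasSum_phiNeg (show 0 < 9 * k by omega)) fun j => ?_
    congr 1
    · rw [zpow_mul]; norm_cast
    · refine X_pow_congr_of_two_mul ?_
      push_cast
      simp only [sq_abs]
      ring
  · rw [← (Equiv.neg ℤ).hasSum_iff]
    refine hasSum_of_eq h1 fun j => ?_
    have e : (X : PowerSeries ℤ) ^ (k * (3 * -j + 1).natAbs ^ 2) = X ^ k *
        X ^ (3 * k * triangular j + 5 * (3 * k) * triangular (-j)) := by
      rw [← pow_add]
      refine X_pow_congr_of_two_mul ?_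
      push_cast
      simp only [sq_abs]
      linear_combination (-3 * k : ℤ) * two_mul_triangular j -
        15 * k * two_mul_triangular (-j)
    simp only [Equiv.neg_apply, Function.comp_apply]
    rw [e, zpow_add_one, zpow_mul, zpow_neg, show ((-1 : ℤˣ) ^ (3 : ℤ)) = -1 from rfl]
    simp
    ring
  · refine hasSum_of_eq h1 fun j => ?_
    have e : (X : PowerSeries ℤ) ^ (k * (3 * j + -1).natAbs ^ 2) = X ^ k *
        X ^ (3 * k * triangular j + 5 * (3 * k) * triangular (-j)) := by
      rw [← pow_add]
      refine X_pow_congr_of_two_mul ?_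
      push_cast
      simp only [sq_abs]
      linear_combination (-3 * k : ℤ) * two_mul_triangular j -
        15 * k * two_mul_triangular (-j)
    rw [e, zpow_add, zpow_mul, show ((-1 : ℤˣ) ^ (3 : ℤ)) = -1 from rfl]
    simp
    ring

theorem finite_setOf_prod_le {e e' : ℤ → ℕ} (h : ∀ n, {i | e i ≤ n}.Finite)
    (h' : ∀ n, {i | e' i ≤ n}.Finite) (n : ℕ) : {p : ℤ × ℤ | e p.1 + e' p.2 ≤ n}.Finite :=
  ((h n).prod (h' n)).subset fun p hp => by
    have hp' : e p.1 + e' p.2 ≤ n := hp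
    exact ⟨show e p.1 ≤ n by omega, show e' p.2 ≤ n by omega⟩

theorem hasSum_mul_of_finite {w w' : ℤ → ℤ} {e e' : ℤ → ℕ} {a b : PowerSeries ℤ}
    (h : ∀ n, {i | e i ≤ n}.Finite) (h' : ∀ n, {i | e' i ≤ n}.Finite)
    (ha : HasSum (fun i => (w i : PowerSeries ℤ) * X ^ e i) a)
    (hb : HasSum (fun i => (w' i : PowerSeries ℤ) * X ^ e' i) b) :
    HasSum (fun p : ℤ × ℤ => (w p.1 : PowerSeries ℤ) * (w' p.2 : PowerSeries ℤ) *
      X ^ (e p.1 + e' p.2)) (a * b) := by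
  refine hasSum_of_eq (ha.mul hb ?_) fun p => ?_
  · refine (summable_intCast_mul_X_pow (fun p : ℤ × ℤ => w p.1 * w' p.2)
      (fun p => e p.1 + e' p.2) (finite_setOf_prod_le h h')).congr fun p => ?_
    push_cast
    ring
  · ring

theorem finite_setOf_sq_le (hk : 0 < k) (n : ℕ) : {j : ℤ | k * j.natAbs ^ 2 ≤ n}.Finite :=
  (finite_setOf_natAbs_le n).subset fun j hj => by
    have h1 : k * j.natAbs ^ 2 ≤ n := hj
    show j.natAbs ≤ n
    nlinarith [Nat.le_mul_of_pos_left (j.natAbs ^ 2) hk, Nat.le_self_pow two_ne_zero j.natAbs]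

theorem finite_setOf_triangular_le (hk : 0 < k) (n : ℕ) :
    {j : ℤ | k * triangular j ≤ n}.Finite :=
  (finite_setOf_natAbs_le (n + 1)).subset fun j hj => by
    have h1 : k * triangular j ≤ n := hj
    show j.natAbs ≤ n + 1
    have h2 := Nat.le_mul_of_pos_left (triangular j) hk
    have h3 := two_mul_triangular j
    have h4 : (triangular j : ℤ) ≤ n := by exact_mod_cast h2.trans h1
    by_contra hc
    rcases le_total 0 j with h | h
    · have : (n : ℤ) + 2 ≤ j := by omega
      nlinarith
    · have : j ≤ -(n : ℤ) - 2 := by omega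
      nlinarith

theorem hasSum_phi_mul_phi_sub (hk : 0 < k) :
    HasSum (fun p : ℤ × ℤ => (1 - (((((-1) ^ (p.1 + p.2) : ℤˣ) : ℤ) : ℤ) : PowerSeries ℤ)) *
      X ^ (k * p.1.natAbs ^ 2 + 3 * k * p.2.natAbs ^ 2))
      (phi k * phi (3 * k) - phiNeg k * phiNeg (3 * k)) := by
  have hk3 : 0 < 3 * k := by omega
  have hF1 := hasSum_mul_of_finite (w := fun _ => 1) (w' := fun _ => 1) (finite_setOf_sq_le hk)
    (finite_setOf_sq_le hk3) (hasSum_of_eq (hasSum_phi hk) fun j => by simp)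
    (hasSum_of_eq (hasSum_phi hk3) fun j => by simp)
  have hF2 := hasSum_mul_of_finite (finite_setOf_sq_le hk) (finite_setOf_sq_le hk3)
    (hasSum_phiNeg hk) (hasSum_phiNeg hk3)
  refine hasSum_of_eq (hF1.sub hF2) fun p => ?_
  rw [← Int.cast_mul, ← Int.cast_mul, ← Units.val_mul, ← zpow_add]
  push_cast
  ring

theorem hasSum_psi_mul_psi (hk : 0 < k) :
    HasSum (fun p : ℤ × ℤ => (X : PowerSeries ℤ) ^
      (k + (2 * k * triangular p.1 + 6 * k * triangular p.2)))
      (X ^ k * (2 * psi (2 * k) * (2 * psi (6 * k)))) := by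
  have hG := (hasSum_mul_of_finite (w := fun _ => 1) (w' := fun _ => 1)
    (finite_setOf_triangular_le (show 0 < 2 * k by omega))
    (finite_setOf_triangular_le (show 0 < 6 * k by omega))
    (hasSum_of_eq (hasSum_two_psi (show 0 < 2 * k by omega)) fun j => by simp)
    (hasSum_of_eq (hasSum_two_psi (show 0 < 6 * k by omega)) fun j => by simp)).mul_left (X ^ k)
  refine hasSum_of_eq hG fun p => ?_
  push_cast
  ring

theorem hasSum_ite_even_sub {M : Type*} [AddCommMonoid M] [TopologicalSpace M] {f : ℤ × ℤ → M}
    {a : M} (h : HasSum (fun p : ℤ × ℤ => f (p.1, p.1 - 2 * p.2)) a) :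
    HasSum (fun p => if (p.1 - p.2) % 2 = 0 then f p else 0) a := by
  have inj : Function.Injective fun p : ℤ × ℤ => (p.1, p.1 - 2 * p.2) := by
    rintro ⟨a, b⟩ ⟨c, d⟩ h
    simp only [Prod.mk.injEq] at h ⊢
    omega
  refine (inj.hasSum_iff fun p hp => if_neg fun h0 => hp ?_).mp (hasSum_of_eq h fun p => ?_)
  · exact ⟨(p.1, (p.1 - p.2) / 2), Prod.ext rfl
      (show p.1 - 2 * ((p.1 - p.2) / 2) = p.2 by omega)⟩
  · simp

theorem hasSum_of_odd_add {M : Type*} [AddCommMonoid M] [TopologicalSpace M] {f : ℤ × ℤ → M}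
    {a : M} (h : HasSum (fun p : ℤ × ℤ => f (2 * p.1 - 3 * p.2 + 1, p.2)) a)
    (h0 : ∀ p : ℤ × ℤ, (p.1 + p.2) % 2 = 0 → f p = 0) : HasSum f a := by
  have inj : Function.Injective fun p : ℤ × ℤ => (2 * p.1 - 3 * p.2 + 1, p.2) := by
    rintro ⟨a, b⟩ ⟨c, d⟩ h
    simp only [Prod.mk.injEq] at h ⊢
    omega
  refine (inj.hasSum_iff fun p hp => h0 p ?_).mp h
  by_contra hodd
  exact hp ⟨((p.1 + 3 * p.2 - 1) / 2, p.2), Prod.ext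
    (show 2 * ((p.1 + 3 * p.2 - 1) / 2) - 3 * p.2 + 1 = p.1 by omega) rfl⟩

theorem triangular_neg_one_sub (j : ℤ) : triangular (-1 - j) = triangular j := by
  have := two_mul_triangular j
  have := two_mul_triangular (-1 - j)
  have : (2 : ℤ) * triangular (-1 - j) = 2 * triangular j := by linarith
  omega

/-- The reflection j ↦ -1 - j of the second index preserves triangular numbers and flips parity, so
index pairs of equal and of opposite parity contribute the same sum z. -/
theorem psi_mul_psi_eq (hk : 0 < k) {z : PowerSeries ℤ}
    (hz : HasSum (fun p : ℤ × ℤ => (X : PowerSeries ℤ) ^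
      (k + (2 * k * triangular p.1 + 6 * k * triangular (p.1 - 2 * p.2)))) z) :
    X ^ k * (2 * psi (2 * k) * (2 * psi (6 * k))) = z + z := by
  have he := hasSum_ite_even_sub (f := fun p : ℤ × ℤ => (X : PowerSeries ℤ) ^
      (k + (2 * k * triangular p.1 + 6 * k * triangular p.2))) hz
  have ho : HasSum (fun p : ℤ × ℤ => if (p.1 - p.2) % 2 = 0 then 0 else
      (X : PowerSeries ℤ) ^ (k + (2 * k * triangular p.1 + 6 * k * triangular p.2))) z := by
    refine (((Equiv.refl ℤ).prodCongr (Equiv.subLeft (-1 : ℤ))).hasSum_iff).mp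
      (hasSum_of_eq he fun p => ?_)
    simp only [Function.comp_apply, Equiv.prodCongr_apply, Equiv.coe_refl, Prod.map_fst,
      Prod.map_snd, id_eq, Equiv.subLeft_apply, triangular_neg_one_sub]
    by_cases h : (p.1 - p.2) % 2 = 0
    · rw [if_pos h, if_neg (by omega)]
    · rw [if_neg h, if_pos (by omega)]
  refine (hasSum_psi_mul_psi hk).unique (hasSum_of_eq (he.add ho) fun p => ?_)
  by_cases h : (p.1 - p.2) % 2 = 0
  · rw [if_pos h, if_pos h, add_zero]
  · rw [if_neg h, if_neg h, zero_add]

/-- The odd part of `φ(q)φ(q³)`. -/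
theorem phi_phi_sub_phiNeg_phiNeg (hk : 0 < k) :
    phi k * phi (3 * k) - phiNeg k * phiNeg (3 * k) =
      4 * X ^ k * psi (2 * k) * psi (6 * k) := by
  have inj : Function.Injective fun p : ℤ × ℤ => (p.1, p.1 - 2 * p.2) := by
    rintro ⟨a, b⟩ ⟨c, d⟩ h
    simp only [Prod.mk.injEq] at h ⊢
    omega
  obtain ⟨z, hz⟩ := (hasSum_psi_mul_psi hk).summable.comp_injective inj
  -- Only a + b odd survives, with weight 2. Substituting a = 2x - 3y + 1, b = y turns a² + 3b² into
  -- 1 + 2T(x) + 6T(x - 2y), T(j) being the triangular number: the equal-parity half of the ψψ sum.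
  have hF : HasSum (fun p : ℤ × ℤ => (1 - (((((-1) ^ (p.1 + p.2) : ℤˣ) : ℤ) : ℤ) :
      PowerSeries ℤ)) * X ^ (k * p.1.natAbs ^ 2 + 3 * k * p.2.natAbs ^ 2)) (2 * z) := by
    refine hasSum_of_odd_add (hasSum_of_eq (hz.mul_left 2) fun p => ?_) fun p hp => ?_
    · have e : (X : PowerSeries ℤ) ^ (k * (2 * p.1 - 3 * p.2 + 1).natAbs ^ 2 +
          3 * k * p.2.natAbs ^ 2) =
          X ^ (k + (2 * k * triangular p.1 + 6 * k * triangular (p.1 - 2 * p.2))) := by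
        refine X_pow_congr_of_two_mul ?_
        push_cast
        simp only [sq_abs]
        linear_combination (-2 * k : ℤ) * two_mul_triangular p.1 -
          6 * k * two_mul_triangular (p.1 - 2 * p.2)
      dsimp only [Function.comp_apply]
      rw [e, Odd.neg_one_zpow (Int.odd_iff.mpr (by omega))]
      push_cast
      ring
    · rw [Even.neg_one_zpow (Int.even_iff.mpr hp)]
      simp
  linear_combination (hasSum_phi_mul_phi_sub hk).unique hF - psi_mul_psi_eq hk hz

end Dissections

/-! ### Extracting arithmetic progressions of coefficients -/

section Sections

theorem expand_theta {m : ℕ} (hm : m ≠ 0) (s : ℤˣ) {u v : ℕ} (hu : 0 < u) (hv : 0 < v) :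
    expand m hm (theta s u v) = theta s (m * u) (m * v) := by
  refine HasSum.unique ?_ (hasSum_theta s (Nat.mul_pos (Nat.pos_of_ne_zero hm) hu)
    (Nat.mul_pos (Nat.pos_of_ne_zero hm) hv))
  rw [WithPiTopology.hasSum_iff_hasSum_coeff]
  intro n
  have h := (WithPiTopology.hasSum_iff_hasSum_coeff ℤ).mp (hasSum_theta s hu hv) (n / m)
  rw [coeff_expand]
  split_ifs with hd
  · obtain ⟨q, rfl⟩ := hd
    rw [Nat.mul_div_cancel_left _ (Nat.pos_of_ne_zero hm)] at h ⊢
    refine hasSum_of_eq h fun k => ?_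
    rw [coeff_intCast_mul_X_pow, coeff_intCast_mul_X_pow, mul_assoc, mul_assoc, ← mul_add]
    simp [hm]
  · refine hasSum_of_eq hasSum_zero fun k => ?_
    rw [coeff_intCast_mul_X_pow, if_neg]
    rintro rfl
    exact hd ⟨u * triangular k + v * triangular (-k), by ring⟩

variable {k : ℕ}

theorem expand_phi {m : ℕ} (hm : m ≠ 0) (hk : 0 < k) : expand m hm (phi k) = phi (m * k) :=
  expand_theta hm 1 hk hk

theorem expand_phiNeg {m : ℕ} (hm : m ≠ 0) (hk : 0 < k) :
    expand m hm (phiNeg k) = phiNeg (m * k) :=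
  expand_theta hm (-1) hk hk

theorem expand_psi {m : ℕ} (hm : m ≠ 0) (hk : 0 < k) : expand m hm (psi k) = psi (m * k) := by
  rw [psi, psi, expand_theta hm 1 hk (by omega), show m * (3 * k) = 3 * (m * k) by ring]

theorem expand_omegaNeg {m : ℕ} (hm : m ≠ 0) (hk : 0 < k) :
    expand m hm (omegaNeg k) = omegaNeg (m * k) := by
  rw [omegaNeg, omegaNeg, expand_theta hm (-1) hk (by omega),
    show m * (5 * k) = 5 * (m * k) by ring]

theorem expand_pent {m : ℕ} (hm : m ≠ 0) (hk : 0 < k) : expand m hm (pent k) = pent (m * k) := by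
  rw [pent, pent, expand_theta hm 1 hk (by omega), show m * (2 * k) = 2 * (m * k) by ring]

theorem expand_euler {m : ℕ} (hm : m ≠ 0) (hk : 0 < k) :
    expand m hm (euler k) = euler (m * k) := by
  rw [euler, euler, expand_theta hm (-1) hk (by omega), show m * (2 * k) = 2 * (m * k) by ring]

/-- The series `∑ aₘₙ₊ᵣ qⁿ` extracted from `∑ aₙ qⁿ`. -/
noncomputable def sect (m r : ℕ) : PowerSeries ℤ →+ PowerSeries ℤ where
  toFun F := mk fun n => coeff (m * n + r) F
  map_add' F G := by ext n; simp
  map_zero' := by ext n; simp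

@[simp]
theorem coeff_sect (m r n : ℕ) (F : PowerSeries ℤ) :
    coeff n (sect m r F) = coeff (m * n + r) F := by
  simp [sect]

theorem sect_X_pow_mul_expand {m : ℕ} (hm : m ≠ 0) {r j : ℕ} (hr : r < m) (hj : j < m)
    (G : PowerSeries ℤ) : sect m r (X ^ j * expand m hm G) = if j = r then G else 0 := by
  ext n
  rw [coeff_sect, coeff_X_pow_mul', coeff_expand]
  split_ifs with h1 h2 h3 h3 h3
  · subst h3
    rw [Nat.add_sub_cancel, Nat.mul_div_cancel_left _ (Nat.pos_of_ne_zero hm)]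
  · exfalso
    apply h3
    have h4 := (Nat.modEq_iff_dvd' h1).mpr h2
    unfold Nat.ModEq at h4
    rw [Nat.mul_add_mod, Nat.mod_eq_of_lt hr, Nat.mod_eq_of_lt hj] at h4
    exact h4
  · subst h3
    exact absurd ⟨n, by omega⟩ h2
  · simp
  · omega
  · simp

theorem sum_X_pow_mul_expand_sect {m : ℕ} (hm : m ≠ 0) (F : PowerSeries ℤ) :
    ∑ j ∈ Finset.range m, X ^ j * expand m hm (sect m j F) = F := by
  ext n
  have hr := Nat.mod_lt n (Nat.pos_of_ne_zero hm)
  have h := congrArg (coeff (n / m)) (map_sum (sect m (n % m))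
    (fun j => X ^ j * expand m hm (sect m j F)) (Finset.range m))
  rw [coeff_sect, Nat.div_add_mod] at h
  rw [h, Finset.sum_congr rfl fun j hj =>
    sect_X_pow_mul_expand hm hr (Finset.mem_range.mp hj) (sect m j F)]
  rw [Finset.sum_ite_eq', if_pos (Finset.mem_range.mpr hr), coeff_sect, Nat.div_add_mod]

/-- Extraction is linear over series in q^m, as seen by decomposing F into its m sections.
Denominators of this kind pass through it. -/
theorem sect_expand_mul {m : ℕ} (hm : m ≠ 0) {r : ℕ} (hr : r < m) (G F : PowerSeries ℤ) :
    sect m r (expand m hm G * F) = G * sect m r F := by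
  conv_lhs => rw [← sum_X_pow_mul_expand_sect hm F]
  rw [Finset.mul_sum, map_sum, Finset.sum_congr rfl fun j hj => by
    rw [show expand m hm G * (X ^ j * expand m hm (sect m j F)) =
      X ^ j * expand m hm (G * sect m j F) by rw [map_mul]; ring,
      sect_X_pow_mul_expand hm hr (Finset.mem_range.mp hj)]]
  rw [Finset.sum_ite_eq', if_pos (Finset.mem_range.mpr hr)]

theorem sect_two {F A B : PowerSeries ℤ}
    (h : F = expand 2 two_ne_zero A + X * expand 2 two_ne_zero B) :
    sect 2 0 F = A ∧ sect 2 1 F = B := by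
  have a (r : ℕ) (hr : r < 2) :=
    sect_X_pow_mul_expand two_ne_zero hr (show 0 < 2 by omega) A
  have b (r : ℕ) (hr : r < 2) :=
    sect_X_pow_mul_expand two_ne_zero hr (show 1 < 2 by omega) B
  simp only [pow_zero, pow_one, one_mul] at a b
  rw [h, map_add, map_add, a 0 (by omega), a 1 (by omega), b 0 (by omega), b 1 (by omega)]
  simp

theorem sect_three {F A B D : PowerSeries ℤ} (h : F = expand 3 three_ne_zero A +
    X * expand 3 three_ne_zero B + X ^ 2 * expand 3 three_ne_zero D) :
    sect 3 1 F = B ∧ sect 3 2 F = D := by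
  have a (r : ℕ) (hr : r < 3) :=
    sect_X_pow_mul_expand three_ne_zero hr (show 0 < 3 by omega) A
  have b (r : ℕ) (hr : r < 3) :=
    sect_X_pow_mul_expand three_ne_zero hr (show 1 < 3 by omega) B
  have d (r : ℕ) (hr : r < 3) :=
    sect_X_pow_mul_expand three_ne_zero hr (show 2 < 3 by omega) D
  simp only [pow_zero, pow_one, one_mul] at a b
  rw [h]
  simp only [map_add]
  rw [a 1 (by omega), a 2 (by omega), b 1 (by omega), b 2 (by omega), d 1 (by omega),
    d 2 (by omega)]
  simp

end Sections

/-! ### Congruences between power series -/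

section Congruences

theorem intCast_dvd_iff (m : ℤ) (F : PowerSeries ℤ) :
    (m : PowerSeries ℤ) ∣ F ↔ ∀ n, m ∣ coeff n F := by
  have hc (G : PowerSeries ℤ) (n : ℕ) : coeff n ((m : PowerSeries ℤ) * G) = m * coeff n G := by
    rw [← map_intCast (C (R := ℤ)), coeff_C_mul]; simp
  constructor
  · rintro ⟨G, rfl⟩ n
    exact ⟨_, hc G n⟩
  · intro h
    choose g hg using h
    exact ⟨mk g, by ext n; rw [hc, coeff_mk, hg]⟩

theorem intCast_dvd_sect {m : ℤ} {F : PowerSeries ℤ} (h : (m : PowerSeries ℤ) ∣ F) (d r : ℕ) :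
    (m : PowerSeries ℤ) ∣ sect d r F := by
  rw [intCast_dvd_iff] at *
  intro n
  rw [coeff_sect]
  exact h _

/-- Frobenius: over `ZMod p`, F(q)^p = F(q^p), since Frobenius fixes the coefficients. -/
theorem dvd_pow_prime_sub_expand (p : ℕ) [hp : Fact p.Prime] (F : PowerSeries ℤ) :
    ((p : ℤ) : PowerSeries ℤ) ∣ F ^ p - expand p hp.out.ne_zero F := by
  rw [intCast_dvd_iff]
  intro n
  rw [← ZMod.intCast_zmod_eq_zero_iff_dvd, show ∀ a : ℤ, (a : ZMod p) = Int.castRingHom (ZMod p) a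
    from fun _ => rfl, ← coeff_map, map_sub, map_pow, map_expand]
  have h := MvPowerSeries.map_frobenius_expand p hp.out.ne_zero
    (f := PowerSeries.map (Int.castRingHom (ZMod p)) F)
  rw [ZMod.frobenius_zmod, MvPowerSeries.map_id] at h
  have h' : expand p hp.out.ne_zero (PowerSeries.map (Int.castRingHom (ZMod p)) F) =
    PowerSeries.map (Int.castRingHom (ZMod p)) F ^ p := h
  rw [h', sub_self, map_zero]

variable {k : ℕ}

theorem constantCoeff_phiNeg (hk : 0 < k) : constantCoeff (phiNeg k) = 1 := by
  rw [phiNeg_eq hk, euler_eq (by omega), map_mul, map_pow,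
    constantCoeff_pochProd _ (by omega) hk, constantCoeff_pochProd _ (by omega) (by omega)]
  rfl

theorem isUnit_of_constantCoeff_eq_one {F : PowerSeries ℤ} (h : constantCoeff F = 1) :
    IsUnit F := by
  rw [PowerSeries.isUnit_iff_constantCoeff, h]
  exact isUnit_one

theorem isUnit_phiNeg (hk : 0 < k) : IsUnit (phiNeg k) :=
  isUnit_of_constantCoeff_eq_one (constantCoeff_phiNeg hk)

open Classical in
/-- `∑_{m ≥ 1} q^(k m²)`. -/
noncomputable def squareSeries (k : ℕ) : PowerSeries ℤ :=
  mk fun n => if ∃ m, 0 < m ∧ n = k * m ^ 2 then 1 else 0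

theorem hasSum_squareSeries (hk : 0 < k) :
    HasSum (fun m : ℕ => (X : PowerSeries ℤ) ^ (k * (m + 1) ^ 2)) (squareSeries k) := by
  have inj : Function.Injective fun m : ℕ => k * (m + 1) ^ 2 := fun a b hab => by
    have h1 := Nat.eq_of_mul_eq_mul_left hk hab
    have h2 := Nat.pow_left_injective two_ne_zero h1
    omega
  have h := (inj.hasSum_iff (f := fun n => monomial n (coeff n (squareSeries k)))
    fun n hn => ?_).mpr
    (squareSeries k).hasSum_of_monomials_self
  · refine hasSum_of_eq h fun m => ?_
    simp only [Function.comp_apply, squareSeries, coeff_mk]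
    rw [if_pos ⟨m + 1, by omega, rfl⟩, ← X_pow_eq]
  · rw [squareSeries, coeff_mk, if_neg, map_zero]
    rintro ⟨m, hm, rfl⟩
    exact hn ⟨m - 1, by simp [Nat.sub_add_cancel hm]⟩

theorem phi_eq_one_add (hk : 0 < k) : phi k = 1 + 2 * squareSeries k := by
  have h := hasSum_squareSeries hk
  have h0 : HasSum (fun n : ℕ => (X : PowerSeries ℤ) ^ (k * (n : ℤ).natAbs ^ 2))
      (1 + squareSeries k) := by
    have := HasSum.zero_add (f := fun n : ℕ => (X : PowerSeries ℤ) ^ (k * (n : ℤ).natAbs ^ 2))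
      (hasSum_of_eq h fun n => by rw [Int.natAbs_natCast])
    simpa using this
  have h1 : HasSum (fun n : ℕ => (X : PowerSeries ℤ) ^ (k * (-((n : ℤ) + 1)).natAbs ^ 2))
      (squareSeries k) :=
    hasSum_of_eq h fun n => by rw [Int.natAbs_neg]; rfl
  have := (hasSum_phi hk).unique (HasSum.of_nat_of_neg_add_one
    (f := fun j : ℤ => (X : PowerSeries ℤ) ^ (k * j.natAbs ^ 2)) h0 h1)
  rw [this]
  ring

theorem phiNeg_eq_phi_sub (hk : 0 < k) : phiNeg k = phi k - 4 * (X ^ k * psi (8 * k)) := by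
  rw [phiNeg_two_dissection hk, phi_two_dissection hk]
  ring

/-- The square of 1 + 2A is 1 + 4A(1 + A). -/
theorem four_dvd_phiNeg_sq_sub_one (hk : 0 < k) : (4 : PowerSeries ℤ) ∣ phiNeg k ^ 2 - 1 := by
  rw [phiNeg_eq_phi_sub hk, phi_eq_one_add hk]
  exact ⟨(squareSeries k - 2 * (X ^ k * psi (8 * k))) *
    (1 + squareSeries k - 2 * (X ^ k * psi (8 * k))), by ring⟩

end Congruences

/-! ### Generating functions of S(2n), S(4n+2), S(12n+6), S(12n+10) -/

section Extraction

theorem intCast_powerSeries_ne_zero {m : ℤ} (hm : m ≠ 0) : (m : PowerSeries ℤ) ≠ 0 := by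
  intro h
  have := congrArg (coeff 0) h
  rw [← map_intCast (C (R := ℤ)), coeff_zero_C] at this
  exact hm (by simpa using this)

theorem schurOverGenFun_three_mul_phiNeg :
    phiNeg 2 * phiNeg 6 * schurOverGenFun 3 = phi 1 * phiNeg 3 := by
  have h := schurOverGenFun_three_mul
  have h3 := phi_mul_phiNeg (k := 3) (by omega)
  norm_num at h3
  refine mul_right_cancel₀ (isUnit_phiNeg (k := 6) (by omega)).ne_zero ?_
  linear_combination phiNeg 3 * h - schurOverGenFun 3 * phiNeg 2 * h3

/-- `∑ S(2n) qⁿ` satisfies this identity. -/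
theorem sect_even_schurOverGenFun_mul :
    phiNeg 2 * phiNeg 6 * sect 2 0 (schurOverGenFun 3) = phi 1 * phi 3 := by
  have e : phiNeg 2 * phiNeg 6 = expand 2 two_ne_zero (phiNeg 1 * phiNeg 3) := by
    rw [map_mul, expand_phiNeg _ (by omega), expand_phiNeg _ (by omega)]
  have h1 := congrArg (sect 2 0) schurOverGenFun_three_mul_phiNeg
  rw [e, sect_expand_mul _ (by omega)] at h1
  have h2 : phi 1 * phiNeg 3 =
      expand 2 two_ne_zero (phi 2 * phi 6 - 4 * X ^ 2 * psi 4 * psi 12) +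
        X * expand 2 two_ne_zero (2 * psi 4 * phi 6 - 2 * X * psi 12 * phi 2) := by
    simp only [map_mul, map_sub, map_pow, expand_X, map_ofNat]
    rw [expand_phi _ (by omega), expand_phi _ (by omega), expand_psi _ (by omega),
      expand_psi _ (by omega), phi_two_dissection (k := 1) (by omega),
      phiNeg_two_dissection (k := 3) (by omega)]
    norm_num
    ring
  rw [(sect_two h2).1] at h1
  have h3 := phi_phi_sub_phiNeg_phiNeg (k := 2) (by omega)
  have h4 := phi_mul_phiNeg (k := 1) (by omega)
  have h5 := phi_mul_phiNeg (k := 3) (by omega)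
  norm_num at h3 h4 h5
  -- So far φ(-q)φ(-q³) ∑ S(2n)qⁿ = φ(-q²)φ(-q⁶). Multiplying by φ(-q²)φ(-q⁶) and using φ(q)φ(-q) =
  -- φ(-q²)² puts the denominator in q², ready for the next 2-dissection.
  refine mul_right_cancel₀ (mul_ne_zero (isUnit_phiNeg (k := 1) (by omega)).ne_zero
    (isUnit_phiNeg (k := 3) (by omega)).ne_zero) ?_
  linear_combination phiNeg 2 * phiNeg 6 * (h1 + h3) - phi 3 * phiNeg 3 * h4 -
    phiNeg 2 ^ 2 * h5

/-- The generating function of `S(4n + 2)`. -/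
noncomputable def schurFourTwo : PowerSeries ℤ := sect 2 1 (sect 2 0 (schurOverGenFun 3))

theorem coeff_schurFourTwo (n : ℕ) : coeff n schurFourTwo = schurOver 3 (4 * n + 2) := by
  rw [schurFourTwo, coeff_sect, coeff_sect, schurOver, show 2 * (2 * n + 1) + 0 = 4 * n + 2 by ring]

/-- The odd part of `φ(q)φ(q³)`. -/
theorem sect_phi_mul_phi : sect 2 1 (phi 1 * phi 3) = 2 * psi 1 * psi 3 := by
  have h1 := phi_phi_sub_phiNeg_phiNeg (k := 1) (by omega)
  have h : phi 1 * phi 3 = expand 2 two_ne_zero (phi 2 * phi 6 + 4 * X ^ 2 * psi 4 * psi 12) +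
      X * expand 2 two_ne_zero (2 * psi 1 * psi 3) := by
    simp only [map_mul, map_add, map_pow, expand_X, map_ofNat]
    rw [expand_phi _ (by omega), expand_phi _ (by omega), expand_psi _ (by omega),
      expand_psi _ (by omega), expand_psi _ (by omega), expand_psi _ (by omega)]
    norm_num at h1 ⊢
    rw [phi_two_dissection (k := 1) (by omega), phi_two_dissection (k := 3) (by omega),
      phiNeg_two_dissection (k := 1) (by omega),
      phiNeg_two_dissection (k := 3) (by omega)] at h1
    rw [phi_two_dissection (k := 1) (by omega), phi_two_dissection (k := 3) (by omega)]
    norm_num at h1 ⊢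
    have h2 : (2 : PowerSeries ℤ) ≠ 0 := by
      simpa using intCast_powerSeries_ne_zero (m := 2) two_ne_zero
    refine mul_left_cancel₀ h2 ?_
    linear_combination h1
  exact (sect_two h).2

theorem schurFourTwo_mul : phiNeg 1 * phiNeg 3 * schurFourTwo = 2 * psi 1 * psi 3 := by
  have e : phiNeg 2 * phiNeg 6 = expand 2 two_ne_zero (phiNeg 1 * phiNeg 3) := by
    rw [map_mul, expand_phiNeg _ (by omega), expand_phiNeg _ (by omega)]
  have h1 := congrArg (sect 2 1) sect_even_schurOverGenFun_mul
  rwa [e, sect_expand_mul _ (by omega), sect_phi_mul_phi] at h1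

/-- The cubic norm `∏ φ(-ωq)` over cube roots of unity `ω`, as a series in `q³`. -/
noncomputable def phiNegNorm : PowerSeries ℤ := phiNeg 3 ^ 3 - 8 * X * omegaNeg 1 ^ 3

theorem isUnit_phiNegNorm : IsUnit phiNegNorm :=
  isUnit_of_constantCoeff_eq_one (by simp [phiNegNorm, constantCoeff_phiNeg])

/-- With φ(-q) = a - b, a = φ(-q⁹), b = 2qω(-q³) (ω(-q) being `omegaNeg 1`), multiplying by a² + ab
+ b² makes the denominator a³ - b³, a series in q³. After `pent_mul_omegaNeg`, the coefficients 1 +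
2 and 2 + 4 of equal terms add up; the prefactor 2 gives 6 and 12. -/
theorem sect_three_schurFourTwo :
    phiNegNorm * phiNeg 1 * sect 3 1 schurFourTwo = 6 * psi 1 * psi 3 * phiNeg 3 ^ 2 ∧
    phiNegNorm * phiNeg 1 * sect 3 2 schurFourTwo =
      12 * (psi 1 * psi 3 * phiNeg 3 * omegaNeg 1) := by
  have hp := psi_three_dissection (k := 1) (by omega)
  have hn := phiNeg_three_dissection (k := 1) (by omega)
  have ha := pent_mul_omegaNeg (k := 3) (by omega)
  norm_num at hp hn ha
  have h : expand 3 three_ne_zero (phiNegNorm * phiNeg 1) * schurFourTwo =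
      expand 3 three_ne_zero (2 * psi 1 * (pent 1 * phiNeg 3 ^ 2 +
        4 * X * psi 3 * omegaNeg 1 ^ 2)) +
      X * expand 3 three_ne_zero (6 * psi 1 * psi 3 * phiNeg 3 ^ 2) +
      X ^ 2 * expand 3 three_ne_zero (12 * (psi 1 * psi 3 * phiNeg 3 * omegaNeg 1)) := by
    simp only [phiNegNorm, map_mul, map_sub, map_add, map_pow, expand_X, map_ofNat]
    rw [expand_phiNeg _ (by omega), expand_phiNeg _ (by omega), expand_psi _ (by omega),
      expand_psi _ (by omega), expand_pent _ (by omega), expand_omegaNeg _ (by omega)]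
    norm_num
    have hs := schurFourTwo_mul
    rw [hp, hn] at hs
    linear_combination (phiNeg 9 ^ 2 + phiNeg 9 * (2 * X * omegaNeg 3) +
      (2 * X * omegaNeg 3) ^ 2) * hs +
      2 * psi 3 * (2 * X * phiNeg 9 + 4 * X ^ 2 * omegaNeg 3) * ha
  have h1 := sect_three h
  rw [sect_expand_mul _ (by omega), sect_expand_mul _ (by omega)] at h1
  exact h1

theorem coeff_sect_three_schurFourTwo (n : ℕ) :
    coeff n (sect 3 1 schurFourTwo) = schurOver 3 (12 * n + 6) ∧
    coeff n (sect 3 2 schurFourTwo) = schurOver 3 (12 * n + 10) := by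
  rw [coeff_sect, coeff_sect, coeff_schurFourTwo, coeff_schurFourTwo]
  constructor <;> congr 1 <;> ring

end Extraction

/-! ### S(12n+6) modulo 3 and 9 -/

section ModThree

theorem three_dvd_pow_three_sub_expand (F : PowerSeries ℤ) :
    (3 : PowerSeries ℤ) ∣ F ^ 3 - expand 3 three_ne_zero F := by
  have : Fact (Nat.Prime 3) := ⟨Nat.prime_three⟩
  simpa using dvd_pow_prime_sub_expand 3 F

/-- Frobenius turns the cubes into φ(-q⁹) - 8qω(-q³), and -8 ≡ -2 recovers the 3-dissection of
φ(-q). -/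
theorem three_dvd_phiNegNorm_sub : (3 : PowerSeries ℤ) ∣ phiNegNorm - phiNeg 1 := by
  obtain ⟨u, hu⟩ := three_dvd_pow_three_sub_expand (phiNeg 3)
  obtain ⟨v, hv⟩ := three_dvd_pow_three_sub_expand (omegaNeg 1)
  rw [expand_phiNeg _ (by omega)] at hu
  rw [expand_omegaNeg _ (by omega)] at hv
  have hn := phiNeg_three_dissection (k := 1) (by omega)
  norm_num at hu hv hn
  refine ⟨u - 8 * X * v - 2 * X * omegaNeg 3, ?_⟩
  rw [phiNegNorm]
  linear_combination hu - 8 * X * hv - hn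

/-- In ψ(q)φ(-q) the exponents 1 modulo 3 carry ψ(q⁹)φ(-q⁹) once directly and -2 times through
`pent_mul_omegaNeg`. The result trades places with the inert factor ψ(q³)φ(-q³). -/
theorem sect_three_psi_mul_phiNeg :
    sect 3 1 (psi 1 * phiNeg 1 * (psi 3 * phiNeg 3)) =
      -(psi 1 * phiNeg 1 * (psi 3 * phiNeg 3)) := by
  have hp := psi_three_dissection (k := 1) (by omega)
  have hn := phiNeg_three_dissection (k := 1) (by omega)
  have ha := pent_mul_omegaNeg (k := 3) (by omega)
  norm_num at hp hn ha
  have h : psi 1 * phiNeg 1 = expand 3 three_ne_zero (pent 1 * phiNeg 3) +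
      X * expand 3 three_ne_zero (-(psi 3 * phiNeg 3)) +
      X ^ 2 * expand 3 three_ne_zero (-(2 * psi 3 * omegaNeg 1)) := by
    simp only [map_mul, map_neg, map_ofNat]
    rw [expand_phiNeg _ (by omega), expand_psi _ (by omega), expand_pent _ (by omega),
      expand_omegaNeg _ (by omega), hp, hn]
    norm_num
    linear_combination (-2 * X) * ha
  have e : psi 3 * phiNeg 3 = expand 3 three_ne_zero (psi 1 * phiNeg 1) := by
    rw [map_mul, expand_phiNeg _ (by omega), expand_psi _ (by omega)]
  rw [mul_comm (psi 1 * phiNeg 1) (psi 3 * phiNeg 3)]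
  conv_lhs => rw [e, sect_expand_mul _ (by omega), (sect_three h).1]
  ring

theorem exists_schurTwelveSix : ∃ K : PowerSeries ℤ, sect 3 1 schurFourTwo = 3 * K ∧
    (3 : PowerSeries ℤ) ∣ K - 2 * (psi 1 * phiNeg 1 * (psi 3 * phiNeg 3)) := by
  have hK := sect_three_schurFourTwo.1
  have hu := isUnit_phiNegNorm.mul (isUnit_phiNeg (k := 1) (by omega))
  obtain ⟨K, hK3⟩ : (3 : PowerSeries ℤ) ∣ sect 3 1 schurFourTwo :=
    hu.dvd_mul_left.mp ⟨2 * psi 1 * psi 3 * phiNeg 3 ^ 2, by rw [hK]; ring⟩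
  refine ⟨K, hK3, (isUnit_phiNeg (k := 3) (by omega)).dvd_mul_left.mp ?_⟩
  obtain ⟨y, hy⟩ := three_dvd_phiNegNorm_sub
  obtain ⟨w, hw⟩ := three_dvd_pow_three_sub_expand (phiNeg 1)
  rw [expand_phiNeg _ (by omega)] at hw
  norm_num at hw
  have h3 : (3 : PowerSeries ℤ) ≠ 0 := by
    simpa using intCast_powerSeries_ne_zero (m := 3) (by norm_num)
  have hK' : phiNegNorm * phiNeg 1 * K = 2 * psi 1 * psi 3 * phiNeg 3 ^ 2 := by
    refine mul_left_cancel₀ h3 ?_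
    rw [hK3] at hK
    linear_combination hK
  -- An extra factor φ(-q) makes the denominator φ(-q)²·`phiNegNorm` ≡ φ(-q)³ ≡ φ(-q³) modulo 3, a
  -- unit that cancels.
  refine ⟨K * (-w - phiNeg 1 ^ 2 * y), ?_⟩
  linear_combination phiNeg 1 * hK' - K * hw - K * phiNeg 1 ^ 2 * hy

theorem three_dvd_schurOver (n : ℕ) : 3 ∣ schurOver 3 (12 * n + 6) := by
  obtain ⟨K, hK, -⟩ := exists_schurTwelveSix
  rw [← (coeff_sect_three_schurFourTwo n).1]
  exact (intCast_dvd_iff 3 _).mp ⟨K, by rw [hK]; norm_num⟩ n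

theorem nine_dvd_schurOver_add (n : ℕ) :
    9 ∣ schurOver 3 (12 * (3 * n + 1) + 6) + schurOver 3 (12 * n + 6) := by
  obtain ⟨K, hK, hV⟩ := exists_schurTwelveSix
  set V := psi 1 * phiNeg 1 * (psi 3 * phiNeg 3)
  have h : ((3 : ℤ) : PowerSeries ℤ) ∣ sect 3 1 K + K := by
    have h1 := intCast_dvd_sect (m := 3) (by simpa using hV) 3 1
    rw [map_sub, two_mul, map_add, sect_three_psi_mul_phiNeg] at h1
    have h2 := dvd_add h1 (by simpa using hV)
    convert h2 using 1
    ring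
  have hc (m : ℕ) : schurOver 3 (12 * m + 6) = 3 * coeff m K := by
    rw [← (coeff_sect_three_schurFourTwo m).1, hK, show (3 : PowerSeries ℤ) = C (3 : ℤ) by simp,
      coeff_C_mul]
  obtain ⟨c, hc'⟩ := (intCast_dvd_iff 3 _).mp h n
  rw [map_add, coeff_sect] at hc'
  rw [hc, hc]
  exact ⟨c, by linear_combination 3 * hc'⟩

end ModThree

/-! ### S(12n+10) modulo 24 and 16 -/

section ModSixteen

theorem exists_schurTwelveTen : ∃ M : PowerSeries ℤ, sect 3 2 schurFourTwo = 12 * M ∧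
    phiNegNorm * phiNeg 1 * M = euler 2 * euler 6 ^ 3 := by
  have hL := sect_three_schurFourTwo.2
  have hW := psi_psi_phiNeg_omegaNeg (k := 1) (by omega)
  norm_num at hW
  rw [hW] at hL
  have hu := isUnit_phiNegNorm.mul (isUnit_phiNeg (k := 1) (by omega))
  obtain ⟨M, hM⟩ : (12 : PowerSeries ℤ) ∣ sect 3 2 schurFourTwo :=
    hu.dvd_mul_left.mp ⟨_, hL⟩
  have h12 : (12 : PowerSeries ℤ) ≠ 0 := by
    simpa using intCast_powerSeries_ne_zero (m := 12) (by norm_num)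
  refine ⟨M, hM, mul_left_cancel₀ h12 ?_⟩
  rw [hM] at hL
  linear_combination hL

theorem sect_two_one_expand (F : PowerSeries ℤ) : sect 2 1 (expand 2 two_ne_zero F) = 0 :=
  (sect_two (A := F) (B := 0) (by simp)).2

theorem euler_two_mul_euler_six :
    euler 2 * euler 6 ^ 3 = expand 2 two_ne_zero (euler 1 * euler 3 ^ 3) := by
  rw [map_mul, map_pow, expand_euler _ (by omega), expand_euler _ (by omega)]

theorem twentyFour_dvd_schurOver (n : ℕ) : 24 ∣ schurOver 3 (24 * n + 22) := by
  obtain ⟨M, hM, hW⟩ := exists_schurTwelveTen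
  have h1 := phiNeg_eq_phi_sub (k := 1) (by omega)
  have h3 := phiNeg_eq_phi_sub (k := 3) (by omega)
  rw [phi_eq_one_add (by omega)] at h1 h3
  -- Both φ(-q) and the norm are 1 modulo 2.
  have h : ((2 : ℤ) : PowerSeries ℤ) ∣ M - euler 2 * euler 6 ^ 3 := by
    obtain ⟨a, ha⟩ : ∃ a, phiNeg 1 = 1 + 2 * a :=
      ⟨squareSeries 1 - 2 * (X ^ 1 * psi (8 * 1)), by rw [h1]; ring⟩
    obtain ⟨b, hb⟩ : ∃ b, phiNeg 3 = 1 + 2 * b :=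
      ⟨squareSeries 3 - 2 * (X ^ 3 * psi (8 * 3)), by rw [h3]; ring⟩
    rw [← hW, phiNegNorm, ha, hb]
    refine ⟨-M * (a + (1 + 2 * a) * (3 * b + 6 * b ^ 2 + 4 * b ^ 3 - 4 * X * omegaNeg 1 ^ 3)), ?_⟩
    push_cast
    ring
  have h' := intCast_dvd_sect h 2 1
  rw [map_sub, euler_two_mul_euler_six, sect_two_one_expand, sub_zero] at h'
  obtain ⟨c, hc⟩ := (intCast_dvd_iff 2 _).mp h' n
  rw [coeff_sect] at hc
  rw [show 24 * n + 22 = 12 * (2 * n + 1) + 10 by ring, ← (coeff_sect_three_schurFourTwo _).2, hM,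
    show (12 : PowerSeries ℤ) = C (12 : ℤ) by simp, coeff_C_mul, hc]
  exact ⟨c, by ring⟩

theorem sixteen_dvd_schurOver (n : ℕ) : 16 ∣ schurOver 3 (48 * n + 46) := by
  obtain ⟨M, hM, hW⟩ := exists_schurTwelveTen
  -- Modulo 4 the norm is φ(-q³)³ ≡ φ(-q³), and 1/φ(-q^k) = φ(q^k)/φ(-q^(2k))² ≡ φ(q^k).
  have h : ((4 : ℤ) : PowerSeries ℤ) ∣ M - euler 2 * euler 6 ^ 3 * (phi 1 * phi 3) := by
    obtain ⟨a, ha⟩ := four_dvd_phiNeg_sq_sub_one (k := 2) (by omega)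
    obtain ⟨b, hb⟩ := four_dvd_phiNeg_sq_sub_one (k := 6) (by omega)
    obtain ⟨c, hc⟩ := four_dvd_phiNeg_sq_sub_one (k := 3) (by omega)
    have h1 := phi_mul_phiNeg (k := 1) (by omega)
    have h3 := phi_mul_phiNeg (k := 3) (by omega)
    norm_num at h1 h3
    refine ⟨M * (2 * X * omegaNeg 1 ^ 3 * phiNeg 2 ^ 2 * phi 3 - a * phiNeg 6 ^ 2 * phiNeg 3 ^ 2 -
      b * phiNeg 3 ^ 2 - c), ?_⟩
    rw [← hW, phiNegNorm]
    push_cast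
    linear_combination (-M * phi 3 * (phiNeg 3 ^ 3 - 8 * X * omegaNeg 1 ^ 3)) * h1 -
      M * phiNeg 2 ^ 2 * phiNeg 3 ^ 2 * h3 - M * phiNeg 6 ^ 2 * phiNeg 3 ^ 2 * ha -
      M * phiNeg 3 ^ 2 * hb - M * hc
  have h' := intCast_dvd_sect h 2 1
  rw [map_sub, euler_two_mul_euler_six, sect_expand_mul _ (by omega), sect_phi_mul_phi] at h'
  have e1 := psi_mul_euler (k := 1) (by omega)
  have e3 := psi_mul_euler (k := 3) (by omega)
  have : Fact (Nat.Prime 2) := ⟨Nat.prime_two⟩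
  obtain ⟨u, hu⟩ := dvd_pow_prime_sub_expand 2 (euler 3)
  rw [expand_euler _ (by omega)] at hu
  norm_num at e1 e3 hu
  -- The odd section is 2E₁E₃³ψ(q)ψ(q³) = 2E₂²E₆²E₃² modulo 4, and the factor 2 allows E₃² to be
  -- replaced by E₆: a series in q² again.
  have h2 : ((4 : ℤ) : PowerSeries ℤ) ∣
      sect 2 1 M - expand 2 two_ne_zero (2 * euler 1 ^ 2 * euler 3 ^ 3) := by
    obtain ⟨v, hv⟩ := h'
    simp only [map_mul, map_pow, map_ofNat]
    rw [expand_euler _ (by omega), expand_euler _ (by omega)]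
    refine ⟨v + euler 2 ^ 2 * euler 6 ^ 2 * u, ?_⟩
    norm_num at hv ⊢
    linear_combination hv + 2 * euler 3 ^ 3 * psi 3 * e1 + 2 * euler 2 ^ 2 * euler 3 ^ 2 * e3 +
      2 * euler 2 ^ 2 * euler 6 ^ 2 * hu
  have h4 := intCast_dvd_sect h2 2 1
  rw [map_sub, sect_two_one_expand, sub_zero] at h4
  obtain ⟨c, hc⟩ := (intCast_dvd_iff 4 _).mp h4 n
  rw [coeff_sect, coeff_sect] at hc
  rw [show 48 * n + 46 = 12 * (2 * (2 * n + 1) + 1) + 10 by ring,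
    ← (coeff_sect_three_schurFourTwo _).2, hM, show (12 : PowerSeries ℤ) = C (12 : ℤ) by simp,
    coeff_C_mul, hc]
  exact ⟨3 * c, by ring⟩

end ModSixteen

/-! ### S(n) modulo 4 and the forms k·□ -/

section ModFour

/-- The number of `k ∣ 6` for which `n` is `k` times a positive square. -/
noncomputable def squareCount (n : ℕ) : ℤ :=
  coeff n (squareSeries 1) + coeff n (squareSeries 2) + coeff n (squareSeries 3) +
    coeff n (squareSeries 6)

/-- Modulo 4 all four theta factors have the form 1 + 2A; these are self-inverse and multiply by
adding the A's. -/
theorem schurOver_modEq_squareCount {n : ℕ} (hn : 0 < n) :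
    schurOver 3 n ≡ 2 * squareCount n [ZMOD 4] := by
  set T : PowerSeries ℤ := 1 +
    (2 : ℤ) • (squareSeries 1 + squareSeries 2 + squareSeries 3 + squareSeries 6) with hT
  have hTc : coeff n T = 2 * squareCount n := by
    rw [hT, map_add, map_smul, coeff_one, if_neg hn.ne']
    simp [squareCount]
  have h : ((4 : ℤ) : PowerSeries ℤ) ∣ T - schurOverGenFun 3 := by
    have hu := (isUnit_phiNeg (k := 2) (by omega)).mul (isUnit_phiNeg (k := 6) (by omega))
    refine hu.dvd_mul_left.mp ?_
    rw [mul_sub, schurOverGenFun_three_mul_phiNeg, phiNeg_eq_phi_sub (k := 2) (by omega),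
      phiNeg_eq_phi_sub (k := 6) (by omega), phiNeg_eq_phi_sub (k := 3) (by omega),
      phi_eq_one_add (by omega), phi_eq_one_add (by omega), phi_eq_one_add (by omega),
      phi_eq_one_add (by omega), hT, zsmul_eq_mul]
    generalize squareSeries 1 = a
    generalize squareSeries 2 = b
    generalize squareSeries 3 = c
    generalize squareSeries 6 = d
    generalize X ^ 2 * psi (8 * 2) = v
    generalize X ^ 6 * psi (8 * 6) = w
    generalize X ^ 3 * psi (8 * 3) = u
    refine ⟨(1 + 2 * a) * u - (1 + 2 * (a + b + c + d)) * (v * (1 + 2 * d) + w * (1 + 2 * b) -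
      4 * v * w) - (a * c - (b + d) - (a + b + c + d) * (b + d) - b * d -
        2 * (a + b + c + d) * b * d), ?_⟩
    push_cast
    ring
  have := (intCast_dvd_iff 4 _).mp h n
  rw [map_sub, hTc] at this
  exact Int.modEq_iff_dvd.mpr this

theorem coeff_squareSeries_congr {k l m n : ℕ}
    (h : (∃ i, 0 < i ∧ m = k * i ^ 2) ↔ ∃ i, 0 < i ∧ n = l * i ^ 2) :
    coeff m (squareSeries k) = coeff n (squareSeries l) := by
  classical
  simp only [squareSeries, coeff_mk]
  exact if_congr h rfl rfl

theorem coeff_squareSeries_mul_mul {p : ℕ} (hp : 0 < p) (k n : ℕ) :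
    coeff (p * n) (squareSeries (p * k)) = coeff n (squareSeries k) := by
  refine coeff_squareSeries_congr (exists_congr fun i => and_congr_right fun _ => ?_)
  rw [mul_assoc, Nat.mul_right_inj hp.ne']

/-- From pn = ki² with p ∤ k follows p ∣ i. So multiplication by p exchanges the forms k·□ and pk·□.
-/
theorem coeff_squareSeries_prime_mul {p : ℕ} (hp : p.Prime) {k : ℕ} (hk : ¬ p ∣ k) (n : ℕ) :
    coeff (p * n) (squareSeries k) = coeff n (squareSeries (p * k)) := by
  refine coeff_squareSeries_congr ⟨?_, ?_⟩
  · rintro ⟨i, hi, h⟩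
    obtain ⟨j, rfl⟩ : p ∣ i :=
      hp.dvd_of_dvd_pow (((hp.dvd_mul).mp ⟨n, h.symm⟩).resolve_left hk)
    refine ⟨j, Nat.pos_of_mul_pos_left hi, Nat.eq_of_mul_eq_mul_left hp.pos ?_⟩
    rw [h]; ring
  · rintro ⟨i, hi, rfl⟩
    exact ⟨p * i, Nat.mul_pos hp.pos hi, by ring⟩

theorem squareCount_two_mul (n : ℕ) : squareCount (2 * n) = squareCount n := by
  have h1 := coeff_squareSeries_prime_mul Nat.prime_two (k := 1) (by decide) n
  have h3 := coeff_squareSeries_prime_mul Nat.prime_two (k := 3) (by decide) n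
  have h2 := coeff_squareSeries_mul_mul two_pos 1 n
  have h6 := coeff_squareSeries_mul_mul two_pos 3 n
  norm_num at h1 h2 h3 h6
  rw [squareCount, squareCount, h1, h2, h3, h6]
  ring

theorem squareCount_three_mul (n : ℕ) : squareCount (3 * n) = squareCount n := by
  have h1 := coeff_squareSeries_prime_mul Nat.prime_three (k := 1) (by decide) n
  have h2 := coeff_squareSeries_prime_mul Nat.prime_three (k := 2) (by decide) n
  have h3 := coeff_squareSeries_mul_mul three_pos 1 n
  have h6 := coeff_squareSeries_mul_mul three_pos 2 n
  norm_num at h1 h2 h3 h6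
  rw [squareCount, squareCount, h1, h2, h3, h6]
  ring

theorem squareCount_two_pow_mul (a n : ℕ) : squareCount (2 ^ a * n) = squareCount n := by
  induction a with
  | zero => simp
  | succ a ih => rw [pow_succ', mul_assoc, squareCount_two_mul, ih]

theorem squareCount_three_pow_mul (a n : ℕ) : squareCount (3 ^ a * n) = squareCount n := by
  induction a with
  | zero => simp
  | succ a ih => rw [pow_succ', mul_assoc, squareCount_three_mul, ih]

/-- Squares are 0, 1 or 4 modulo 8, so k·□ with k ∣ 6 is never 5 or 7, and is 3 only for k = 3,
which forces 3 ∣ n. -/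
theorem squareCount_eq_zero {n : ℕ} (h : n % 8 = 5 ∨ n % 8 = 7 ∨ (n % 8 = 3 ∧ n % 3 ≠ 0)) :
    squareCount n = 0 := by
  have key (i : ℕ) : i ^ 2 % 8 = 0 ∨ i ^ 2 % 8 = 1 ∨ i ^ 2 % 8 = 4 := by
    have : i % 8 < 8 := Nat.mod_lt _ (by omega)
    rw [Nat.pow_mod]
    interval_cases i % 8 <;> simp
  have z {k : ℕ} (hk : k = 1 ∨ k = 2 ∨ k = 3 ∨ k = 6) : coeff n (squareSeries k) = 0 := by
    rw [squareSeries, coeff_mk, if_neg]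
    rintro ⟨i, -, rfl⟩
    have := key i
    rcases hk with rfl | rfl | rfl | rfl <;> omega
  rw [squareCount, z, z, z, z] <;> simp

theorem schurOver_modEq_of_squareCount_eq {m n : ℕ} (hm : 0 < m) (hn : 0 < n)
    (h : squareCount m = squareCount n) : schurOver 3 m ≡ schurOver 3 n [ZMOD 4] := by
  refine (schurOver_modEq_squareCount hm).trans ?_
  rw [h]
  exact (schurOver_modEq_squareCount hn).symm

theorem four_dvd_schurOver {m n a b : ℕ} (hm : m = 2 ^ a * (3 ^ b * n))
    (h : n % 8 = 5 ∨ n % 8 = 7 ∨ (n % 8 = 3 ∧ n % 3 ≠ 0)) : 4 ∣ schurOver 3 m := by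
  have hpos : 0 < m := by
    have : 0 < n := by omega
    rw [hm]; positivity
  have := schurOver_modEq_squareCount hpos
  rw [hm, squareCount_two_pow_mul, squareCount_three_pow_mul, squareCount_eq_zero h, ← hm] at this
  exact Int.modEq_zero_iff_dvd.mp this

end ModFour

/-! ### Iterating multiplication by 3, and the final assembly -/

section Powers

theorem exists_three_pow_mul (a n : ℕ) : ∃ m, 3 ^ a * (12 * n + 6) = 12 * m + 6 := by
  induction a with
  | zero => exact ⟨n, by simp⟩
  | succ a ih =>
    obtain ⟨m, hm⟩ := ih
    exact ⟨3 * m + 1, by rw [pow_succ', mul_assoc, hm]; ring⟩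

theorem schurOver_three_pow_modEq_nine (a n : ℕ) :
    schurOver 3 (3 ^ a * (12 * n + 6)) ≡ (-1) ^ a * schurOver 3 (12 * n + 6) [ZMOD 9] := by
  induction a with
  | zero => simp [Int.ModEq]
  | succ a ih =>
    obtain ⟨m, hm⟩ := exists_three_pow_mul a n
    have h := nine_dvd_schurOver_add m
    rw [show 12 * (3 * m + 1) + 6 = 3 * (12 * m + 6) by ring, ← hm, ← mul_assoc, ← pow_succ'] at h
    have h2 : schurOver 3 (3 ^ (a + 1) * (12 * n + 6)) ≡
        -schurOver 3 (3 ^ a * (12 * n + 6)) [ZMOD 9] := by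
      rw [Int.modEq_iff_dvd]
      obtain ⟨c, hc⟩ := h
      exact ⟨-c, by linear_combination -hc⟩
    refine h2.trans ?_
    rw [pow_succ, mul_neg_one, neg_mul]
    exact ih.neg

theorem twelve_dvd_schurOver {m n a b : ℕ} (k : ℕ) (hk : m = 12 * k + 6)
    (hm : m = 2 ^ a * (3 ^ b * n)) (h : n % 8 = 5 ∨ n % 8 = 7 ∨ (n % 8 = 3 ∧ n % 3 ≠ 0)) :
    schurOver 3 m ≡ 0 [ZMOD 12] := by
  have h4 := four_dvd_schurOver hm h
  have h3 := three_dvd_schurOver k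
  rw [← hk] at h3
  exact Int.modEq_zero_iff_dvd.mpr (by omega)

end Powers

theorem theorem4p3 (n α : ℕ) :
    schurOver 3 (2 ^ α * (2 * n)) ≡ schurOver 3 (2 * n) [ZMOD 4] ∧
    schurOver 3 (3 ^ α * (2 * n + 1)) ≡ schurOver 3 (2 * n + 1) [ZMOD 4] ∧
    schurOver 3 (32 * n + 20) ≡ 0 [ZMOD 4] ∧
    (∀ j ∈ Finset.Icc 1 5, schurOver 3 (96 * n + 16 * j + 12) ≡ 0 [ZMOD 4]) ∧
    schurOver 3 (3 ^ α * (12 * n + 6)) ≡ (-1) ^ α * schurOver 3 (12 * n + 6) [ZMOD 9] ∧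
    schurOver 3 (3 ^ α * (12 * n + 6)) ≡ schurOver 3 (12 * n + 6) [ZMOD 12] ∧
    (∀ i ∈ Finset.Icc 1 5, schurOver 3 (144 * n + 24 * i + 18) ≡ 0 [ZMOD 12]) ∧
    schurOver 3 (48 * n + 30) ≡ 0 [ZMOD 12] ∧
    schurOver 3 (48 * n + 42) ≡ 0 [ZMOD 12] ∧
    schurOver 3 (48 * n + 46) ≡ 0 [ZMOD 16] ∧
    schurOver 3 (24 * n + 22) ≡ 0 [ZMOD 24] := by
  refine ⟨?_, ?_, ?_, fun j hj => ?_, schurOver_three_pow_modEq_nine α n, ?_, fun i hi => ?_, ?_,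
    ?_, Int.modEq_zero_iff_dvd.mpr (sixteen_dvd_schurOver n),
    Int.modEq_zero_iff_dvd.mpr (twentyFour_dvd_schurOver n)⟩
  -- The count of square forms describes only positive arguments; at n = 0 both sides coincide.
  · rcases Nat.eq_zero_or_pos n with rfl | hn
    · simp [Int.ModEq]
    · exact schurOver_modEq_of_squareCount_eq (by positivity) (by positivity)
        (squareCount_two_pow_mul _ _)
  · exact schurOver_modEq_of_squareCount_eq (by positivity) (by positivity)
      (squareCount_three_pow_mul _ _)
  · exact Int.modEq_zero_iff_dvd.mpr
      (four_dvd_schurOver (n := 8 * n + 5) (a := 2) (b := 0) (by ring) (by omega))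
  -- After removing 4, the cofactor 24n + 4j + 3 is 7 modulo 8 for odd j, and 3 modulo 8 but prime
  -- to 3 for j = 2, 4. The next range argument, with 6 removed, is the same.
  · rw [Finset.mem_Icc] at hj
    exact Int.modEq_zero_iff_dvd.mpr
      (four_dvd_schurOver (n := 24 * n + 4 * j + 3) (a := 2) (b := 0) (by ring) (by omega))
  · have h4 := schurOver_modEq_of_squareCount_eq (m := 3 ^ α * (12 * n + 6)) (n := 12 * n + 6)
      (by positivity) (by positivity) (squareCount_three_pow_mul _ _)
    obtain ⟨m, hm⟩ := exists_three_pow_mul α n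
    have h3 := three_dvd_schurOver m
    have h3' := three_dvd_schurOver n
    rw [← hm] at h3
    have h4' := h4.dvd
    exact Int.modEq_iff_dvd.mpr (by omega)
  · rw [Finset.mem_Icc] at hi
    exact twelve_dvd_schurOver (n := 24 * n + 4 * i + 3) (a := 1) (b := 1) (12 * n + 2 * i + 1)
      (by ring) (by ring) (by omega)
  · exact twelve_dvd_schurOver (n := 8 * n + 5) (a := 1) (b := 1) (4 * n + 2)
      (by ring) (by ring) (by omega)
  · exact twelve_dvd_schurOver (n := 8 * n + 7) (a := 1) (b := 1) (4 * n + 3)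
      (by ring) (by ring) (by omega)
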